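/- Let $n\ge 0$ and consider strictly proper rational matrices $G(s)\in\mathbb{C}(s)^{n\times n}$. The McMillan degree of $G$ is the least $d$ such that $G(s)=C(sI_d-A)^{-1}B$ with complex matrices $A,B,C$. For $\delta\ge 0$ let $SRat_{\delta,n}(\mathbb{C})$ (respectively $Ham_{\delta,n}(\mathbb{C})$) be the set of strictly proper $n\times n$ transfer functions $G$ of McMillan degree $\delta$ that are symmetric, $G(s)^t=G(s)$ (respectively Hamiltonian, $G(-s)^t=G(s)$). These sets carry the Zariski topology as subsets of the affine space $(\mathbb{C}^{n\times n})^{2\delta}$ via $G\mapsto(H_0,\dots,H_{2\delta-1})$, where $G(s)=\sum_{k\ge0}H_ks^{-k-1}$ is the expansion at infinity. Let $N=\binom{2n}{n}-1$, and let $LG(n)\subset\mathbb{P}^N$ be the Zariski closure of the set of all points $\mathrm{rowsp}\,[F\ I_n]$, $F$ a complex symmetric $n\times n$ matrix, under the Plücker embedding. For a left coprime factorization $G(s)=D(s)^{-1}N(s)$ by polynomial matrices, let $p_i(s)$ be the cofactors of the Plücker coordinates $f_i$ of $\mathrm{rowsp}\,[F_1\ F_2]$ in the expansion $$\det\begin{pmatrix}D(s)&N(s)\\F_1&F_2\end{pmatrix}=\sum_{i=0}^N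 p_i(s)f_i ,$$ and let $\mathcal{Z}=\{z\in\mathbb{P}^N\mid \sum_i p_i(s)z_i=0\}$, which does not depend on the choice of the factorization. Call $G$ nondegenerate if $\mathcal{Z}\cap LG(n)=\emptyset$. Then: 1. If $\delta=\binom{n+1}{2}$, the set of nondegenerate $G\in SRat_{\delta,n}(\mathbb{C})$ is a nonempty, dense, Zariski-open subset of $SRat_{\delta,n}(\mathbb{C})$. 2. If $\delta=n(n+1)$, the set of nondegenerate $G\in Ham_{\delta,n}(\mathbb{C})$ is a nonempty, dense, Zariski-open subset of $Ham_{\delta,n}(\mathbb{C})$. -/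

import Mathlib

open scoped LinearAlgebra.Projectivization

noncomputable section

namespace TransferFunction

/-! ### Transfer functions -/

/-- The rational function `f(g(s))`. It is only used for `g = -s` and `g = 1/s`, where no
denominator of a rational function becomes zero. -/
def subst (f g : RatFunc ℂ) : RatFunc ℂ :=
  RatFunc.eval RatFunc.C g f

/-- Every entry has a numerator of smaller degree than its denominator. -/
def IsStrictlyProper {n : ℕ} (G : Matrix (Fin n) (Fin n) (RatFunc ℂ)) : Prop :=
  ∀ i j, (G i j).num.degree < (G i j).denom.degree

/-- `(A, B, C)` is a realization: `G(s) = C (s I - A)⁻¹ B`. -/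
def IsRealization {n d : ℕ} (G : Matrix (Fin n) (Fin n) (RatFunc ℂ))
    (A : Matrix (Fin d) (Fin d) ℂ) (B : Matrix (Fin d) (Fin n) ℂ)
    (C : Matrix (Fin n) (Fin d) ℂ) : Prop :=
  G = C.map RatFunc.C *
    (Matrix.scalar (Fin d) (RatFunc.X : RatFunc ℂ) - A.map RatFunc.C)⁻¹ * B.map RatFunc.C

/-- The McMillan degree of `G` is `δ`: the least state space dimension of a realization is `δ`. -/
def HasMcMillanDegree {n : ℕ} (G : Matrix (Fin n) (Fin n) (RatFunc ℂ)) (δ : ℕ) : Prop :=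
  IsLeast {d : ℕ | ∃ (A : Matrix (Fin d) (Fin d) ℂ) (B : Matrix (Fin d) (Fin n) ℂ)
    (C : Matrix (Fin n) (Fin d) ℂ), IsRealization G A B C} δ

/-- Strictly proper `n × n` transfer functions of McMillan degree `δ` with `G(s)ᵗ = G(s)`. -/
def SRat (n δ : ℕ) : Set (Matrix (Fin n) (Fin n) (RatFunc ℂ)) :=
  {G | IsStrictlyProper G ∧ HasMcMillanDegree G δ ∧ G.transpose = G}

/-- Strictly proper `n × n` transfer functions of McMillan degree `δ` with `G(-s)ᵗ = G(s)`. -/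
def Ham (n δ : ℕ) : Set (Matrix (Fin n) (Fin n) (RatFunc ℂ)) :=
  {G | IsStrictlyProper G ∧ HasMcMillanDegree G δ ∧
    (G.map fun f => subst f (-RatFunc.X)).transpose = G}

/-! ### The Zariski topology on spaces of transfer functions, and genericity -/

/-- The Zariski topology on the affine space `ℂ^ι`, induced by the map that sends a point to its
maximal ideal in the prime spectrum of the polynomial ring. -/
abbrev zariskiTopology (ι : Type) : TopologicalSpace (ι → ℂ) :=
  TopologicalSpace.induced
    (MvPolynomial.pointToPoint : (ι → ℂ) → PrimeSpectrum (MvPolynomial ι ℂ)) inferInstance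

/-- The closed sets are the zero sets of families of polynomials. -/
theorem isClosed_zariskiTopology_iff (ι : Type) (Z : Set (ι → ℂ)) :
    @IsClosed _ (zariskiTopology ι) Z ↔
      ∃ P : Set (MvPolynomial ι ℂ), Z = {x | ∀ p ∈ P, MvPolynomial.eval x p = 0} := by
  have key : ∀ (s : Set (MvPolynomial ι ℂ)),
      (MvPolynomial.pointToPoint : (ι → ℂ) → PrimeSpectrum (MvPolynomial ι ℂ)) ⁻¹'
        PrimeSpectrum.zeroLocus s = {x | ∀ p ∈ s, MvPolynomial.eval x p = 0} := by
    intro s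
    ext x
    simp only [Set.mem_preimage, PrimeSpectrum.mem_zeroLocus, Set.mem_ofPred_eq]
    constructor
    · intro h p hp
      exact (MvPolynomial.mem_vanishingIdeal_singleton_iff x p).1 (h hp)
    · intro h p hp
      exact (MvPolynomial.mem_vanishingIdeal_singleton_iff x p).2 (h p hp)
  unfold zariskiTopology
  rw [isClosed_induced_iff]
  constructor
  · rintro ⟨t, ht, rfl⟩
    obtain ⟨s, rfl⟩ := (PrimeSpectrum.isClosed_iff_zeroLocus t).1 ht
    exact ⟨s, key s⟩
  · rintro ⟨s, rfl⟩
    exact ⟨_, PrimeSpectrum.isClosed_zeroLocus s, key s⟩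

/-- The coefficient `h_k` of `s^(-k-1)` in the expansion `f(s) = ∑ h_k s^(-k-1)` at infinity of a
strictly proper `f`, read off from the Laurent expansion of `f(1/t)` at `t = 0`. -/
def markovCoeff (f : RatFunc ℂ) (k : ℕ) : ℂ :=
  ((subst f (RatFunc.X⁻¹) : RatFunc ℂ) : LaurentSeries ℂ).coeff ((k : ℤ) + 1)

/-- The first `2δ` Markov parameters `H_0, …, H_{2δ-1}` of `G`, where `G(s) = ∑ H_k s^(-k-1)`.
They determine every `G` of McMillan degree `δ`. -/
def markovMap {n : ℕ} (δ : ℕ) (G : Matrix (Fin n) (Fin n) (RatFunc ℂ)) :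
    Fin (2 * δ) × Fin n × Fin n → ℂ :=
  fun x => markovCoeff (G x.2.1 x.2.2) x.1

/-- The Zariski topology on a set `S` of strictly proper transfer functions of McMillan
degree `δ`, embedded by the Markov parameters as a subset of an affine space. -/
abbrev transferTopology {n : ℕ} (δ : ℕ) (S : Set (Matrix (Fin n) (Fin n) (RatFunc ℂ))) :
    TopologicalSpace S :=
  TopologicalSpace.induced (fun G : S => markovMap δ G.1)
    (zariskiTopology (Fin (2 * δ) × Fin n × Fin n))

/-- The property `E` is generic on `S`: it holds exactly on a nonempty, dense, Zariski-open
subset of `S`. -/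
def IsGeneric {n : ℕ} (δ : ℕ) (S : Set (Matrix (Fin n) (Fin n) (RatFunc ℂ)))
    (E : Matrix (Fin n) (Fin n) (RatFunc ℂ) → Prop) : Prop :=
  {G : S | E G.1}.Nonempty ∧
  @IsOpen S (transferTopology δ S) {G : S | E G.1} ∧
  @Dense S (transferTopology δ S) {G : S | E G.1}

/-! ### The Lagrangian Grassmannian in the Plücker space -/

/-- The `n`-element sets of columns of an `n × 2n` matrix; the `N + 1 = (2n choose n)` indices of
the Plücker coordinates. -/
abbrev PluckerIndex (n : ℕ) : Type := {S : Finset (Fin (n + n)) // S.card = n}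

/-- The columns in `S`, in increasing order, of a matrix `[F₁ F₂]`. -/
def PluckerIndex.col {n : ℕ} (S : PluckerIndex n) (a : Fin n) : Fin n ⊕ Fin n :=
  finSumFinEquiv.symm (S.1.orderEmbOfFin S.2 a)

/-- The Plücker coordinates of `rowsp [F₁ F₂]`: the full size minors of `[F₁ F₂]`. -/
def plucker {n : ℕ} (F₁ F₂ : Matrix (Fin n) (Fin n) ℂ) : PluckerIndex n → ℂ :=
  fun S => ((Matrix.fromCols F₁ F₂).submatrix id S.col).det

theorem plucker_graph_ne_zero {n : ℕ} (F : Matrix (Fin n) (Fin n) ℂ) : plucker F 1 ≠ 0 := by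
  intro h
  let S : PluckerIndex n := ⟨Finset.univ.map (Fin.natAddEmb n), by simp⟩
  have hcol : ∀ a : Fin n, S.col a = Sum.inr a := by
    intro a
    have h1 := Finset.orderEmbOfFin_unique S.2 (f := Fin.natAdd n)
      (fun x => by simp [S]) (Fin.strictMono_natAdd n)
    unfold PluckerIndex.col
    rw [← congrFun h1 a, ← finSumFinEquiv_apply_right, Equiv.symm_apply_apply]
  have h2 : plucker F 1 S = 1 := by
    unfold plucker
    rw [← Matrix.det_one (n := Fin n) (R := ℂ)]
    congr 1
    ext i j
    simp [hcol]
  rw [h] at h2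
  simp at h2

/-- The projective space `ℙ^N`, `N = (2n choose n) - 1`. -/
abbrev PluckerSpace (n : ℕ) : Type := ℙ ℂ (PluckerIndex n → ℂ)

/-- The Zariski closure of a subset of a projective space: the common zeros of all homogeneous
polynomials that vanish on the subset. -/
def projectiveClosure {ι : Type} (S : Set (ℙ ℂ (ι → ℂ))) : Set (ℙ ℂ (ι → ℂ)) :=
  {z | ∀ (d : ℕ) (p : MvPolynomial ι ℂ), p.IsHomogeneous d →
    (∀ w ∈ S, MvPolynomial.eval w.rep p = 0) → MvPolynomial.eval z.rep p = 0}

/-- The complex Lagrangian Grassmannian `LG(n)`: the Zariski closure in `ℙ^N` of the set of all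
`rowsp [F I]` with `F` symmetric. -/
def LG (n : ℕ) : Set (PluckerSpace n) :=
  projectiveClosure {z | ∃ F : Matrix (Fin n) (Fin n) ℂ, F.IsSymm ∧
    z = Projectivization.mk ℂ (plucker F 1) (plucker_graph_ne_zero F)}

/-! ### The center of the pole placement map, and nondegeneracy -/

open Polynomial in
/-- `G = D⁻¹ N` is a left coprime factorization by polynomial matrices. -/
def IsLeftCoprimeFactorization {n : ℕ} (G : Matrix (Fin n) (Fin n) (RatFunc ℂ))
    (D N : Matrix (Fin n) (Fin n) ℂ[X]) : Prop :=
  D.det ≠ 0 ∧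
  G = (D.map (algebraMap ℂ[X] (RatFunc ℂ)))⁻¹ * N.map (algebraMap ℂ[X] (RatFunc ℂ)) ∧
  ∃ U V : Matrix (Fin n) (Fin n) ℂ[X], D * U + N * V = 1

open Polynomial in
/-- The cofactor `p_S(s)` of the Plücker coordinate `f_S` of `[F₁ F₂]` in the determinant of the
block matrix with rows `[D(s) N(s)]` and `[F₁ F₂]`: the value of this determinant when the lower
rows are the standard basis vectors with indices in `S`, in increasing order. -/
def cofactor {n : ℕ} (D N : Matrix (Fin n) (Fin n) ℂ[X]) (S : PluckerIndex n) : ℂ[X] :=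
  (Matrix.fromRows (Matrix.fromCols D N)
    (Matrix.of fun (a : Fin n) (c : Fin n ⊕ Fin n) => if S.col a = c then (1 : ℂ[X]) else 0)).det

open Polynomial in
/-- The center `Z = {z ∈ ℙ^N | ∑ p_S(s) z_S = 0}`. -/
def center {n : ℕ} (D N : Matrix (Fin n) (Fin n) ℂ[X]) : Set (PluckerSpace n) :=
  {z | ∑ S : PluckerIndex n, cofactor D N S * Polynomial.C (z.rep S) = 0}

open Polynomial in
/-- `G` is nondegenerate: the center `Z` defined by a left coprime factorization of `G`
(`Z` does not depend on its choice) does not meet `LG(n)`. -/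
def IsNondegenerate {n : ℕ} (G : Matrix (Fin n) (Fin n) (RatFunc ℂ)) : Prop :=
  ∃ D N : Matrix (Fin n) (Fin n) ℂ[X],
    IsLeftCoprimeFactorization G D N ∧ center D N ∩ LG n = ∅

end TransferFunction

end

open scoped LinearAlgebra.Projectivization

noncomputable section

namespace TransferFunction

/-! In each case it suffices that nondegeneracy is an open condition, that the space of transfer
functions is irreducible, and that one nondegenerate member exists: a nonempty open subset of an
irreducible space is dense.

Openness. Up to the factor `det D`, the form defining the center is the combination of the bordered
determinants of `[I G]` with coefficients `z_S` (`mem_center_iff`), so it depends on `G` alone.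
Expanded at infinity it has a denominator of degree at most `δ`, so it vanishes as soon as its first
`2δ + 1` coefficients do (`minorSum_eq_zero_iff`). These coefficients are linear forms in `z` whose
coefficients are polynomials in the Markov parameters. That they have no common zero on the
projective set `LG n` is an open condition by elimination theory (`isOpen_forall_exists_ne_zero`).

Irreducibility. Put `ε = 1` in the symmetric and `ε = -1` in the Hamiltonian case. Every minimal
realization can be brought to the form `(W S, W B, Bᵗ)` with `Wᵗ = ε W` and `Sᵗ = S`
(`exists_symmetric_realization`). Such triples form a vector space, and minimality means that some
Hankel minor is nonzero. A line joining points over two nonempty open sets therefore has a point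
that lies over both (`preirreducibleSpace_of_symmetric`).

Example. Take `diag(s^(-m_i))` with distinct positive `m_i`. Its cofactors are monomials in `s`,
nonzero only for Lagrangian coordinate subspaces. Give the two columns with index `i` the weights
`-m_i` and `m_i`. The exchange and isotropy relations show that a point of `LG n` has exactly one
nonzero coordinate of least weight and that its index is Lagrangian, so its monomial cannot cancel
(`center_diagonal_inter_LG`). The McMillan degree is `∑ m_i`; the exponents `1, …, n` serve the
symmetric case and `2, 4, …, 2n` the Hamiltonian one. -/

/-! ### Elimination: openness of the absence of projective common zeros -/

section Elimination

open MvPolynomial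

/-- The homogeneous components of an element of an ideal generated by homogeneous polynomials
belong to the ideal. -/
theorem homogeneousComponent_mem_span {ι : Type*} {s : Set (MvPolynomial ι ℂ)}
    (hs : ∀ p ∈ s, ∃ d, p.IsHomogeneous d) {f : MvPolynomial ι ℂ} (hf : f ∈ Ideal.span s) (d : ℕ) :
    homogeneousComponent d f ∈ Ideal.span s := by
  let _ := MvPolynomial.gradedAlgebra (σ := ι) (R := ℂ)
  have h := Ideal.homogeneous_span (homogeneousSubmodule ι ℂ) s (fun p hp => by
    obtain ⟨d, hd⟩ := hs p hp
    exact ⟨d, hd⟩) d hf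
  have h2 := decomposition.decompose'_apply f d
  rw [← h2]
  exact h

/-- The homogeneous polynomials that vanish on a subset of a projective space. -/
def homogeneousVanishing {ι : Type} (S : Set (ℙ ℂ (ι → ℂ))) : Set (MvPolynomial ι ℂ) :=
  {p | (∃ d, p.IsHomogeneous d) ∧ ∀ w ∈ S, eval w.rep p = 0}

theorem eval_rep_eq_zero {ι : Type} {S : Set (ℙ ℂ (ι → ℂ))} {z : ℙ ℂ (ι → ℂ)}
    (hz : z ∈ projectiveClosure S) {p : MvPolynomial ι ℂ}
    (hp : p ∈ Ideal.span (homogeneousVanishing S)) : eval z.rep p = 0 := by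
  have : Ideal.span (homogeneousVanishing S) ≤ RingHom.ker (eval z.rep) := by
    rw [Ideal.span_le]
    rintro q ⟨⟨d, hd⟩, hq⟩
    exact hz d q hd hq
  exact this hp

theorem eval_smul_of_isHomogeneous {ι : Type*} {p : MvPolynomial ι ℂ} {d : ℕ}
    (hp : p.IsHomogeneous d) (a : ℂ) (v : ι → ℂ) : eval (a • v) p = a ^ d * eval v p := by
  rw [eval_eq, eval_eq, Finset.mul_sum]
  refine Finset.sum_congr rfl fun m hm => ?_
  have hd : m.degree = d := by
    rw [Finsupp.degree_eq_weight_one]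
    exact hp (mem_support_iff.1 hm)
  simp only [Pi.smul_apply, smul_eq_mul, mul_pow, Finset.prod_mul_distrib, Finset.prod_pow_eq_pow_sum]
  rw [← hd, Finsupp.degree_apply]
  ring

/-- If an ideal has no zeros except perhaps the origin, then it contains all monomials of some
degree. -/
theorem exists_forall_monomial_mem {ι : Type} [Fintype ι] {J : Ideal (MvPolynomial ι ℂ)}
    (hJ : ∀ v : ι → ℂ, (∀ p ∈ J, eval v p = 0) → v = 0) :
    ∃ d : ℕ, 0 < d ∧ ∀ m : ι →₀ ℕ, m.degree = d → monomial m (1 : ℂ) ∈ J := by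
  have h1 : ∀ i, ∃ k, (X i : MvPolynomial ι ℂ) ^ k ∈ J := by
    intro i
    have : (X i : MvPolynomial ι ℂ) ∈ J.radical := by
      rw [← vanishingIdeal_zeroLocus_eq_radical (K := ℂ), mem_vanishingIdeal_iff]
      intro v hv
      rw [hJ v fun p hp => by simpa [aeval_eq_eval] using hv p hp]
      simp
    exact this
  choose k hk using h1
  -- Above the degree `∑ i, k i` some exponent must exceed its `k i`. The added 1 also makes the
  -- degree positive, so that later `z_i ^ d = 0` gives `z_i = 0`.
  refine ⟨∑ i, k i + 1, by omega, fun m hm => ?_⟩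
  obtain ⟨i, -, hi⟩ : ∃ i ∈ Finset.univ, k i < m i := by
    apply Finset.exists_lt_of_sum_lt
    have : m.degree = ∑ i, m i := by
      rw [Finsupp.degree_apply]
      exact Finset.sum_subset (Finset.subset_univ _) (by simp)
    omega
  have : monomial m (1 : ℂ) = monomial (m - Finsupp.single i (k i)) 1 * X i ^ k i := by
    rw [X_pow_eq_monomial, monomial_mul, mul_one, tsub_add_cancel_of_le]
    rw [Finsupp.single_le_iff]
    exact hi.le
  rw [this]
  exact J.mul_mem_left _ (hk i)

/-- The set of parameters `x` for which the linear forms with coefficients `c k i` at `x` have no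
common zero on a Zariski closed subset of a projective space is Zariski open. -/
theorem isOpen_forall_exists_ne_zero {ι τ : Type} [Fintype ι] {κ : Type*} [Fintype κ]
    (S : Set (ℙ ℂ (ι → ℂ))) (c : κ → ι → MvPolynomial τ ℂ) :
    @IsOpen _ (zariskiTopology τ)
      {x | ∀ z ∈ projectiveClosure S, ∃ k, ∑ i, eval x (c k i) * z.rep i ≠ 0} := by
  classical
  let _ := zariskiTopology τ
  let ℓ : (τ → ℂ) → κ → MvPolynomial ι ℂ := fun x k => ∑ i, C (eval x (c k i)) * X i
  have hℓ : ∀ x k v, eval v (ℓ x k) = ∑ i, eval x (c k i) * v i := by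
    intro x k v
    simp [ℓ]
  have hℓhom : ∀ x k, (ℓ x k).IsHomogeneous 1 := fun x k =>
    IsHomogeneous.sum _ _ _ fun i _ => by
      simpa using (isHomogeneous_C ι (eval x (c k i))).mul (isHomogeneous_X ℂ i)
  rw [isOpen_iff_forall_mem_open]
  intro x₀ hx₀
  let J : Ideal (MvPolynomial ι ℂ) :=
    Ideal.span (homogeneousVanishing S) ⊔ Ideal.span (Set.range (ℓ x₀))
  have hJ : ∀ v : ι → ℂ, (∀ p ∈ J, eval v p = 0) → v = 0 := by
    intro v hv
    by_contra hv0
    let z : ℙ ℂ (ι → ℂ) := Projectivization.mk ℂ v hv0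
    obtain ⟨a, ha⟩ : ∃ a : ℂˣ, a • v = z.rep := Projectivization.exists_smul_eq_mk_rep ℂ v hv0
    have ha' : z.rep = (a : ℂ) • v := ha.symm
    have hz : z ∈ projectiveClosure S := by
      intro d p hp hS
      rw [ha', eval_smul_of_isHomogeneous hp,
        hv p (Ideal.mem_sup_left (Ideal.subset_span ⟨⟨d, hp⟩, hS⟩)), mul_zero]
    obtain ⟨k, hk⟩ := hx₀ z hz
    apply hk
    rw [← hℓ, ha', eval_smul_of_isHomogeneous (hℓhom x₀ k),
      hv _ (Ideal.mem_sup_right (Ideal.subset_span ⟨k, rfl⟩)), mul_zero]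
  obtain ⟨d, hd0, hd⟩ := exists_forall_monomial_mem hJ
  have hfin : {m : ι →₀ ℕ | m.degree = d}.Finite := by
    exact (Finset.finite_toSet ((Finset.univ : Finset ι).finsuppAntidiag d)).subset fun m hm => by
      have h0 : m.degree = ∑ i, m i := by
        rw [Finsupp.degree_apply]
        exact Finset.sum_subset (Finset.subset_univ _) (by simp)
      simp only [Set.mem_ofPred_eq] at hm
      simp [Finset.mem_finsuppAntidiag, ← h0, hm]
  have : Fintype {m : ι →₀ ℕ // m.degree = d} := hfin.fintype
  let M := {m : ι →₀ ℕ // m.degree = d}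
  have hdec : ∀ m : M, ∃ a : κ → MvPolynomial ι ℂ,
      monomial m.1 (1 : ℂ) - ∑ k, a k * ℓ x₀ k ∈ Ideal.span (homogeneousVanishing S) := by
    intro m
    obtain ⟨p, hp, q, hq, hpq⟩ := Submodule.mem_sup.1 (hd m.1 m.2)
    obtain ⟨a, ha⟩ := (Ideal.mem_span_range_iff_exists_fun).1 hq
    refine ⟨a, ?_⟩
    rw [ha, ← hpq, add_sub_cancel_right]
    exact hp
  choose a ha using hdec
  let L : M → MvPolynomial ι (MvPolynomial τ ℂ) := fun m =>
    ∑ k, map C (a m k) * ∑ i, C (c k i) * X i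
  have hL : ∀ x m, map (eval x) (L m) = ∑ k, a m k * ℓ x k := by
    intro x m
    simp only [L, ℓ, map_sum, map_mul, map_map, map_C, map_X]
    refine Finset.sum_congr rfl fun k _ => ?_
    congr 1
    convert map_id (a m k)
    ext r
    simp
  -- At `x₀` each monomial of degree `d` equals `∑ a ℓ` modulo the vanishing ideal, and `N` records
  -- how this identity changes with the parameter. It is the identity matrix at `x₀`, and if the
  -- forms at `x` have a common zero `z` on the closure, it kills the vector of degree `d` monomials
  -- of `z`. So `det N ≠ 0` defines an open neighbourhood of `x₀` without common zeros.
  let N : Matrix M M (MvPolynomial τ ℂ) := fun m m' =>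
    coeff m'.1 (L m) - C (coeff m'.1 (∑ k, a m k * ℓ x₀ k)) + if m = m' then 1 else 0
  have hN : ∀ x m m', eval x (N m m') = coeff m'.1 (∑ k, a m k * ℓ x k)
      - coeff m'.1 (∑ k, a m k * ℓ x₀ k) + if m = m' then 1 else 0 := by
    intro x m m'
    rw [← hL x m, coeff_map]
    simp only [N, map_add, map_sub, eval_C, add_right_inj]
    split_ifs <;> simp
  have hcomp : ∀ (f : MvPolynomial ι ℂ) (v : ι → ℂ),
      eval v (homogeneousComponent d f) = ∑ m : M, coeff m.1 f * eval v (monomial m.1 1) := by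
    intro f v
    have h1 : homogeneousComponent d f = ∑ m : M, monomial m.1 (coeff m.1 f) := by
      ext m
      rw [coeff_homogeneousComponent, coeff_sum]
      simp only [coeff_monomial]
      split_ifs with hm
      · rw [Finset.sum_eq_single ⟨m, hm⟩]
        · simp
        · rintro ⟨m', hm'⟩ - hne
          rw [if_neg]
          rintro rfl
          exact hne rfl
        · simp
      · rw [Finset.sum_eq_zero]
        rintro ⟨m', hm'⟩ -
        rw [if_neg]
        rintro rfl
        exact hm hm'
    rw [h1, map_sum]
    simp [eval_monomial]
  refine ⟨{x | eval x N.det ≠ 0}, ?_, ?_, ?_⟩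
  · intro x hx z hz
    by_contra! hcon
    have hker : ∀ m : M, ∑ m' : M, eval x (N m m') * eval z.rep (monomial m'.1 1) = 0 := by
      intro m
      have e1 : eval z.rep (homogeneousComponent d (∑ k, a m k * ℓ x k)) = 0 := by
        have : homogeneousComponent d (∑ k, a m k * ℓ x k) ∈ Ideal.span (Set.range (ℓ x)) := by
          apply homogeneousComponent_mem_span
          · rintro _ ⟨k, rfl⟩
            exact ⟨1, hℓhom x k⟩
          · exact Ideal.sum_mem _ fun k _ => Ideal.mul_mem_left _ _ (Ideal.subset_span ⟨k, rfl⟩)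
        have hle : Ideal.span (Set.range (ℓ x)) ≤ RingHom.ker (eval z.rep) := by
          rw [Ideal.span_le]
          rintro _ ⟨k, rfl⟩
          exact (hℓ x k z.rep).trans (hcon k)
        exact hle this
      have e2 : eval z.rep (monomial m.1 1)
          - eval z.rep (homogeneousComponent d (∑ k, a m k * ℓ x₀ k)) = 0 := by
        have h3 := eval_rep_eq_zero hz (homogeneousComponent_mem_span (fun p hp => hp.1) (ha m) d)
        rw [map_sub, map_sub, homogeneousComponent_of_mem
          (show monomial m.1 (1 : ℂ) ∈ homogeneousSubmodule ι ℂ d from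
            isHomogeneous_monomial 1 m.2), if_pos rfl] at h3
        exact h3
      simp only [hN, add_mul, sub_mul, Finset.sum_add_distrib, Finset.sum_sub_distrib, ite_mul,
        one_mul, zero_mul]
      rw [← hcomp, ← hcomp, e1, Fintype.sum_eq_single m fun m' h => if_neg h.symm, if_pos rfl]
      linear_combination e2
    have hv0 : (fun m' : M => eval z.rep (monomial m'.1 1)) = 0 := by
      apply Matrix.eq_zero_of_mulVec_eq_zero (M := N.map (eval x))
      · rw [← RingHom.mapMatrix_apply, ← RingHom.map_det]
        exact hx
      · ext m
        exact hker m
    apply z.rep_nonzero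
    ext i
    have := congrFun hv0 ⟨Finsupp.single i d, by simp⟩
    simpa [eval_monomial, hd0.ne'] using this
  · have : IsClosed {x : τ → ℂ | eval x N.det = 0} :=
      (isClosed_zariskiTopology_iff τ _).2 ⟨{N.det}, by simp⟩
    simpa [Set.compl_def] using this.isOpen_compl
  · have : N.map (eval x₀) = 1 := by
      ext m m'
      simp [hN, Matrix.one_apply]
    simp only [Set.mem_ofPred_eq, RingHom.map_det, RingHom.mapMatrix_apply, this, Matrix.det_one]
    exact one_ne_zero

end Elimination

/-! ### Plücker coordinates with arbitrary column tuples -/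

/-- The coordinate of `z` at a tuple `c` of columns that need not be increasing: up to the sign of
the sorting permutation the coordinate at the range of `c`, and zero if `c` is not injective. -/
def tupleCoord {R : Type*} [CommRing R] {n : ℕ} (z : PluckerIndex n → R)
    (c : Fin n → Fin n ⊕ Fin n) : R :=
  ∑ S : PluckerIndex n, z S * ((1 : Matrix (Fin n ⊕ Fin n) (Fin n ⊕ Fin n) R).submatrix S.col c).det

theorem PluckerIndex.col_injective {n : ℕ} (S : PluckerIndex n) : Function.Injective S.col :=
  finSumFinEquiv.symm.injective.comp (S.1.orderEmbOfFin S.2).injective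

theorem PluckerIndex.range_col {n : ℕ} (S : PluckerIndex n) :
    Set.range S.col = finSumFinEquiv.symm '' S.1 := by
  have : S.col = finSumFinEquiv.symm ∘ S.1.orderEmbOfFin S.2 := rfl
  rw [this, Set.range_comp, Finset.range_orderEmbOfFin]

theorem PluckerIndex.eq_of_range_col_eq {n : ℕ} {S T : PluckerIndex n}
    (h : Set.range S.col = Set.range T.col) : S = T := by
  rw [S.range_col, T.range_col] at h
  exact Subtype.ext (Finset.coe_injective (finSumFinEquiv.symm.injective.image_injective h))

/-- A nonzero minor of the identity matrix selects the same columns and rows. -/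
theorem exists_perm_of_det_submatrix_one_ne_zero {R : Type*} [CommRing R] {n : ℕ}
    {κ : Type*} [DecidableEq κ] {r c : Fin n → κ}
    (h : ((1 : Matrix κ κ R).submatrix r c).det ≠ 0) :
    ∃ σ : Equiv.Perm (Fin n), ∀ b, r (σ b) = c b := by
  rw [Matrix.det_apply] at h
  obtain ⟨σ, -, hσ⟩ := Finset.exists_ne_zero_of_sum_ne_zero h
  refine ⟨σ, fun b => ?_⟩
  by_contra hb
  apply hσ
  rw [Finset.prod_eq_zero (Finset.mem_univ b), smul_zero]
  simp [hb]

theorem exists_perm_of_tupleCoord_ne_zero {R : Type*} [CommRing R] {n : ℕ}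
    {z : PluckerIndex n → R} {c : Fin n → Fin n ⊕ Fin n} (h : tupleCoord z c ≠ 0) :
    ∃ S, z S ≠ 0 ∧ ∃ σ : Equiv.Perm (Fin n), ∀ b, S.col (σ b) = c b := by
  obtain ⟨S, -, hS⟩ := Finset.exists_ne_zero_of_sum_ne_zero h
  exact ⟨S, left_ne_zero_of_mul hS,
    exists_perm_of_det_submatrix_one_ne_zero (right_ne_zero_of_mul hS)⟩

theorem tupleCoord_col {R : Type*} [CommRing R] {n : ℕ} (z : PluckerIndex n → R)
    (S : PluckerIndex n) : tupleCoord z S.col = z S := by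
  rw [tupleCoord, Finset.sum_eq_single S]
  · rw [Matrix.submatrix_one _ S.col_injective, Matrix.det_one, mul_one]
  · rintro T - hT
    by_contra h
    obtain ⟨σ, hσ⟩ := exists_perm_of_det_submatrix_one_ne_zero (right_ne_zero_of_mul h)
    apply hT
    apply PluckerIndex.eq_of_range_col_eq
    rw [← σ.surjective.range_comp]
    exact congrArg Set.range (funext hσ)
  · simp

/-- The tuple of columns `c` is a permutation of an increasing one if it is injective. -/
theorem exists_pluckerIndex_of_injective {n : ℕ} {c : Fin n → Fin n ⊕ Fin n}
    (hc : Function.Injective c) :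
    ∃ (S : PluckerIndex n) (σ : Equiv.Perm (Fin n)), ∀ b, S.col (σ b) = c b := by
  let S : PluckerIndex n := ⟨Finset.univ.image (finSumFinEquiv ∘ c), by
    rw [Finset.card_image_of_injective _ (finSumFinEquiv.injective.comp hc)]; simp⟩
  have hr : Set.range S.col = Set.range c := by
    rw [S.range_col]
    simp only [S, Finset.coe_image, Finset.coe_univ, Set.image_univ, Set.range_comp]
    rw [← Set.image_comp]
    simp
  have hex : ∀ b, ∃ a, S.col a = c b := fun b => by
    have : c b ∈ Set.range S.col := hr ▸ ⟨b, rfl⟩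
    exact this
  choose σ hσ using hex
  have hσi : Function.Injective σ := fun a b hab => hc (by rw [← hσ, ← hσ, hab])
  exact ⟨S, Equiv.ofBijective σ (Finite.injective_iff_bijective.1 hσi), hσ⟩

/-- Sorting `c` produces the same sign on both sides, and both sides vanish when a column repeats.
Thus identities between minors with unsorted columns become polynomial relations in the Plücker
coordinates. -/
theorem tupleCoord_plucker {n : ℕ} (F₁ F₂ : Matrix (Fin n) (Fin n) ℂ)
    (c : Fin n → Fin n ⊕ Fin n) :
    tupleCoord (plucker F₁ F₂) c = ((Matrix.fromCols F₁ F₂).submatrix id c).det := by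
  by_cases hc : Function.Injective c
  · obtain ⟨S, σ, hσ⟩ := exists_pluckerIndex_of_injective hc
    have hc' : c = S.col ∘ σ := (funext hσ).symm
    have h1 : ∀ {κ : Type} (M : Matrix κ (Fin n ⊕ Fin n) ℂ) (r : Fin n → κ),
        (M.submatrix r c).det = Equiv.Perm.sign σ * (M.submatrix r S.col).det := by
      intro κ M r
      rw [← Matrix.det_permute', hc']
      rfl
    have h2 : tupleCoord (plucker F₁ F₂) c
        = Equiv.Perm.sign σ * tupleCoord (plucker F₁ F₂) S.col := by
      simp only [tupleCoord, h1, Finset.mul_sum]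
      exact Finset.sum_congr rfl fun _ _ => by ring
    rw [h2, h1, tupleCoord_col]
    rfl
  · have : ∃ a b, c a = c b ∧ a ≠ b := by
      simpa [Function.Injective] using hc
    obtain ⟨a, b, hab, hne⟩ := this
    rw [Matrix.det_zero_of_column_eq hne fun i => by simp [hab]]
    by_contra h
    obtain ⟨S, -, σ, hσ⟩ := exists_perm_of_tupleCoord_ne_zero h
    apply hne
    apply σ.injective
    apply S.col_injective
    rw [hσ, hσ, hab]

theorem map_tupleCoord {R R' : Type*} [CommRing R] [CommRing R'] (f : R →+* R') {n : ℕ}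
    (z : PluckerIndex n → R) (c : Fin n → Fin n ⊕ Fin n) :
    f (tupleCoord z c) = tupleCoord (f ∘ z) c := by
  simp only [tupleCoord, map_sum, map_mul, Function.comp_apply, RingHom.map_det,
    RingHom.mapMatrix_apply]
  refine Finset.sum_congr rfl fun S _ => ?_
  congr 2
  ext i j
  simp [Matrix.one_apply]

theorem tupleCoord_smul {R : Type*} [CommRing R] {n : ℕ} (a : R) (z : PluckerIndex n → R)
    (c : Fin n → Fin n ⊕ Fin n) : tupleCoord (a • z) c = a * tupleCoord z c := by
  simp [tupleCoord, Finset.mul_sum, mul_assoc]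

open MvPolynomial in
theorem isHomogeneous_tupleCoord {n : ℕ} (c : Fin n → Fin n ⊕ Fin n) :
    (tupleCoord (X : PluckerIndex n → MvPolynomial (PluckerIndex n) ℂ) c).IsHomogeneous 1 := by
  refine IsHomogeneous.sum _ _ _ fun S _ => ?_
  have : ((1 : Matrix (Fin n ⊕ Fin n) (Fin n ⊕ Fin n) (MvPolynomial (PluckerIndex n) ℂ)).submatrix
      S.col c).det = C ((1 : Matrix (Fin n ⊕ Fin n) (Fin n ⊕ Fin n) ℂ).submatrix S.col c).det := by
    rw [RingHom.map_det, RingHom.mapMatrix_apply]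
    congr 1
    ext1 i j
    simp [Matrix.one_apply]
  rw [this]
  simpa using (isHomogeneous_X ℂ S).mul (isHomogeneous_C (PluckerIndex n) _)

open MvPolynomial in
theorem eval_tupleCoord {n : ℕ} (z : PluckerIndex n → ℂ) (c : Fin n → Fin n ⊕ Fin n) :
    eval z (tupleCoord X c) = tupleCoord z c := by
  rw [map_tupleCoord]
  congr 1
  ext S
  simp

/-! ### Exchange and isotropy relations, and their extension to `LG n`. -/

open Matrix in
/-- The exchange relation for the maximal minors of a matrix. -/
theorem det_mul_det_eq_sum_exchange {R κ : Type*} [CommRing R] {n : ℕ} (M : Matrix (Fin n) κ R)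
    (c c' : Fin n → κ) (i : Fin n) :
    (M.submatrix id c).det * (M.submatrix id c').det =
      ∑ j, (M.submatrix id (Function.update c i (c' j))).det *
        (M.submatrix id (Function.update c' j (c i))).det := by
  have hupd : ∀ (c : Fin n → κ) (i : Fin n) (k : κ),
      (M.submatrix id (Function.update c i k)) = (M.submatrix id c).updateCol i (fun a => M a k) := by
    intro c i k
    ext a b
    by_cases h : b = i
    · subst h; simp
    · simp [h]
  -- Cramer's rule writes the column `c i`, times the minor at `c'`, as a combination of the columns
  -- `c' j`. Substituting this into place `i` of the minor at `c` gives the relation by linearity.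
  have hcr := Matrix.mulVec_cramer (M.submatrix id c') (fun a => M a (c i))
  have h1 : (M.submatrix id c).cramer ((M.submatrix id c').det • fun a => M a (c i)) i =
      (M.submatrix id c).det * (M.submatrix id c').det := by
    rw [map_smul, Pi.smul_apply, cramer_apply, ← hupd, Function.update_eq_self, smul_eq_mul,
      mul_comm]
  rw [← h1, ← hcr]
  have h2 : (M.submatrix id c') *ᵥ (M.submatrix id c').cramer (fun a => M a (c i)) =
      ∑ j, (M.submatrix id c').cramer (fun a => M a (c i)) j • fun a => M a (c' j) := by
    ext a
    simp [mulVec, dotProduct, Finset.sum_apply, mul_comm]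
  rw [h2, map_sum, Finset.sum_apply]
  refine Finset.sum_congr rfl fun j _ => ?_
  rw [map_smul, Pi.smul_apply, cramer_apply, cramer_apply, ← hupd, ← hupd, smul_eq_mul, mul_comm]

open Matrix in
/-- The linear relation for the maximal minors of `[F I]` with `F` symmetric that says that the row
space is isotropic. -/
theorem sum_det_update_update_eq_zero {n : ℕ} {F : Matrix (Fin n) (Fin n) ℂ} (hF : F.IsSymm)
    (c : Fin n → Fin n ⊕ Fin n) {p q : Fin n} (hpq : p ≠ q) :
    ∑ j, ((fromCols F 1).submatrix id
      (Function.update (Function.update c p (Sum.inl j)) q (Sum.inr j))).det = 0 := by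
  let M := (fromCols F (1 : Matrix (Fin n) (Fin n) ℂ)).submatrix id c
  let β : (Fin n → ℂ) → (Fin n → ℂ) → ℂ := fun x y => ((M.updateCol p x).updateCol q y).det
  have hupd : ∀ j, ((fromCols F 1).submatrix id
      (Function.update (Function.update c p (Sum.inl j)) q (Sum.inr j))).det =
      β (fun a => F a j) (Pi.single j 1) := by
    intro j
    simp only [β]
    congr 1
    ext a b
    by_cases h : b = q
    · subst h; simp [Matrix.one_apply, Pi.single_apply]
    · by_cases h' : b = p
      · subst h'; simp [h]
      · simp [h, h', M]
  have hsum : ∀ (x : Fin n → ℂ) y, β x y = ∑ a, x a * β (Pi.single a 1) y := by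
    intro x y
    have hcomm : ∀ x y, β x y = ((M.updateCol q y).updateCol p x).det := by
      intro x y
      simp only [β]
      rw [updateCol_comm _ hpq]
    simp only [hcomm, ← cramer_apply]
    conv_lhs => rw [pi_eq_sum_univ' x]
    rw [map_sum, Finset.sum_apply]
    refine Finset.sum_congr rfl fun a _ => ?_
    rw [map_smul, Pi.smul_apply, smul_eq_mul]
  have hswap : ∀ x y, β x y = -β y x := by
    intro x y
    have h1 : β (x + y) (x + y) = 0 := by
      apply det_zero_of_column_eq hpq
      intro a
      simp [hpq]
    have hl : ∀ x y w, β (x + y) w = β x w + β y w := by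
      intro x y w
      rw [hsum, hsum x, hsum y, ← Finset.sum_add_distrib]
      simp [add_mul]
    have hr : ∀ x y w, β w (x + y) = β w x + β w y := by
      intro x y w
      simp only [β]
      rw [det_updateCol_add]
    have hd : ∀ x, β x x = 0 := by
      intro x
      apply det_zero_of_column_eq hpq
      intro a
      simp [hpq]
    rw [hl, hr, hr, hd, hd] at h1
    linear_combination h1
  simp only [hupd]
  -- In the standard basis the sum is `∑ F a b * β e_a e_b`. Since `F` is symmetric and `β`
  -- alternating, it equals its own negative.
  have key : ∑ j, β (fun a => F a j) (Pi.single j 1) =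
      -∑ j, β (fun a => F a j) (Pi.single j 1) := by
    conv_lhs =>
      enter [2, j]
      rw [hsum]
    conv_rhs =>
      enter [1, 2, j]
      rw [hsum]
    conv_lhs => rw [Finset.sum_comm]
    rw [← Finset.sum_neg_distrib]
    refine Finset.sum_congr rfl fun a _ => ?_
    rw [← Finset.sum_neg_distrib]
    refine Finset.sum_congr rfl fun b _ => ?_
    rw [hF.apply a b]
    linear_combination F a b * hswap (Pi.single a 1) (Pi.single b 1)
  linear_combination (1 / 2 : ℂ) * key

theorem rep_mk_eq_smul {n : ℕ} (v : PluckerIndex n → ℂ) (hv : v ≠ 0) :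
    ∃ a : ℂ, (Projectivization.mk ℂ v hv).rep = a • v := by
  obtain ⟨a, ha⟩ := Projectivization.exists_smul_eq_mk_rep ℂ v hv
  exact ⟨a, ha.symm⟩

-- The relation is homogeneous of degree 2 and holds for the minors of every `[F I]`, hence on the
-- closure.
open MvPolynomial in
theorem LG_exchange {n : ℕ} {z : PluckerSpace n} (hz : z ∈ LG n) (c c' : Fin n → Fin n ⊕ Fin n)
    (i : Fin n) :
    tupleCoord z.rep c * tupleCoord z.rep c' =
      ∑ j, tupleCoord z.rep (Function.update c i (c' j)) *
        tupleCoord z.rep (Function.update c' j (c i)) := by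
  rw [← sub_eq_zero]
  have h := hz 2 (tupleCoord X c * tupleCoord X c' - ∑ j, tupleCoord X (Function.update c i (c' j)) *
        tupleCoord X (Function.update c' j (c i))) ?_ ?_
  · simpa [eval_tupleCoord] using h
  · exact IsHomogeneous.sub ((isHomogeneous_tupleCoord _).mul (isHomogeneous_tupleCoord _))
      (IsHomogeneous.sum _ _ _ fun j _ =>
        (isHomogeneous_tupleCoord _).mul (isHomogeneous_tupleCoord _))
  · rintro w ⟨F, -, rfl⟩
    obtain ⟨a, ha⟩ := rep_mk_eq_smul (plucker F 1) (plucker_graph_ne_zero F)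
    simp only [map_sub, map_mul, map_sum, eval_tupleCoord, ha, tupleCoord_smul, tupleCoord_plucker]
    have := det_mul_det_eq_sum_exchange (Matrix.fromCols F 1) c c' i
    rw [sub_eq_zero, mul_mul_mul_comm, this, Finset.mul_sum]
    exact Finset.sum_congr rfl fun j _ => by ring

-- A linear relation on the graphs passes to the closure. The symmetry of `F` is used here and not
-- in `LG_exchange`: this relation carries the Lagrangian condition.
open MvPolynomial in
theorem LG_isotropic {n : ℕ} {z : PluckerSpace n} (hz : z ∈ LG n) (c : Fin n → Fin n ⊕ Fin n)
    {p q : Fin n} (hpq : p ≠ q) :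
    ∑ j, tupleCoord z.rep (Function.update (Function.update c p (Sum.inl j)) q (Sum.inr j)) = 0 := by
  have h := hz 1 (∑ j, tupleCoord X (Function.update (Function.update c p (Sum.inl j)) q
    (Sum.inr j))) (IsHomogeneous.sum _ _ _ fun j _ => isHomogeneous_tupleCoord _) ?_
  · simpa [eval_tupleCoord] using h
  · rintro w ⟨F, hF, rfl⟩
    obtain ⟨a, ha⟩ := rep_mk_eq_smul (plucker F 1) (plucker_graph_ne_zero F)
    simp only [map_sum, eval_tupleCoord, ha, tupleCoord_smul, tupleCoord_plucker]
    rw [← Finset.mul_sum, sum_det_update_update_eq_zero hF c hpq, mul_zero]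

/-! ### Points of the Lagrangian Grassmannian and torus weights -/

/-- Weights of the columns of `[F₁ F₂]` that are opposite on the two blocks. -/
def colWeight {n : ℕ} (m : Fin n → ℕ) : Fin n ⊕ Fin n → ℤ :=
  Sum.elim (fun i => -(m i : ℤ)) fun i => (m i : ℤ)

theorem colWeight_injective {n : ℕ} {m : Fin n → ℕ} (hm : Function.Injective m)
    (hpos : ∀ i, 0 < m i) : Function.Injective (colWeight m) := by
  rintro (i | i) (j | j) h
  all_goals
    have hi := hpos i
    have hj := hpos j
    simp only [colWeight, Sum.elim_inl, Sum.elim_inr] at h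
  · exact congrArg _ (hm (by omega))
  · omega
  · omega
  · exact congrArg _ (hm (by omega))

/-- The weight of a Plücker coordinate. -/
def PluckerIndex.weight {n : ℕ} (m : Fin n → ℕ) (S : PluckerIndex n) : ℤ :=
  ∑ a, colWeight m (S.col a)

theorem exists_weight_eq_of_tupleCoord_ne_zero {n : ℕ} (m : Fin n → ℕ) {z : PluckerIndex n → ℂ}
    {c : Fin n → Fin n ⊕ Fin n} (h : tupleCoord z c ≠ 0) :
    ∃ S, z S ≠ 0 ∧ S.weight m = ∑ a, colWeight m (c a) ∧ Set.range S.col = Set.range c ∧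
      Function.Injective c := by
  obtain ⟨S, hS, σ, hσ⟩ := exists_perm_of_tupleCoord_ne_zero h
  have hc : c = S.col ∘ σ := (funext hσ).symm
  refine ⟨S, hS, ?_, ?_, ?_⟩
  · rw [hc]
    exact (Equiv.sum_comp σ fun a => colWeight m (S.col a)).symm
  · rw [hc, σ.surjective.range_comp]
  · rw [hc]
    exact S.col_injective.comp σ.injective

/-- An exchange term puts some `B.col j` in place of `A.col i`. If that column already occurs in
`A`, the tuple repeats a column; otherwise the choice of `i` makes the weight drop strictly, below
the minimum. Either way the first factor is zero. -/
theorem mul_eq_zero_of_max_mem {n : ℕ} {m : Fin n → ℕ} (hm : Function.Injective m)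
    (hpos : ∀ i, 0 < m i) {z : PluckerSpace n} (hz : z ∈ LG n) {A B : PluckerIndex n}
    (hA : ∀ S, z.rep S ≠ 0 → A.weight m ≤ S.weight m) {i : Fin n}
    (hi : A.col i ∉ Set.range B.col)
    (hmax : ∀ j, B.col j ∉ Set.range A.col → colWeight m (B.col j) ≤ colWeight m (A.col i)) :
    z.rep A * z.rep B = 0 := by
  rw [← tupleCoord_col z.rep A, ← tupleCoord_col z.rep B, LG_exchange hz _ _ i]
  refine Finset.sum_eq_zero fun j _ => ?_
  by_contra hne
  obtain ⟨S, hS, hw, -, hinj⟩ := exists_weight_eq_of_tupleCoord_ne_zero m (left_ne_zero_of_mul hne)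
  have hj : B.col j ≠ A.col i := fun h => hi ⟨j, h⟩
  have hj' : B.col j ∉ Set.range A.col := by
    rintro ⟨l, hl⟩
    have hli : l ≠ i := by
      rintro rfl
      exact hj hl.symm
    apply hli
    apply hinj
    simp [hli, hl]
  have hlt : colWeight m (B.col j) < colWeight m (A.col i) :=
    lt_of_le_of_ne (hmax j hj') fun h => hj (colWeight_injective hm hpos h)
  have h1 := hA S hS
  have h2 : (fun a => colWeight m (Function.update A.col i (B.col j) a)) =
      Function.update (fun a => colWeight m (A.col a)) i (colWeight m (B.col j)) := by
    ext a
    by_cases h : a = i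
    · subst h; simp
    · simp [h]
  rw [hw, PluckerIndex.weight, h2, Finset.sum_update_of_mem (Finset.mem_univ i),
    ← Finset.add_sum_erase _ _ (Finset.mem_univ i), Finset.sdiff_singleton_eq_erase] at h1
  linarith

/-- The nonzero Plücker coordinate of minimal weight is unique. -/
theorem eq_of_minimal_weight {n : ℕ} {m : Fin n → ℕ} (hm : Function.Injective m)
    (hpos : ∀ i, 0 < m i) {z : PluckerSpace n} (hz : z ∈ LG n) {A B : PluckerIndex n}
    (hA : ∀ S, z.rep S ≠ 0 → A.weight m ≤ S.weight m)
    (hB : ∀ S, z.rep S ≠ 0 → B.weight m ≤ S.weight m) (hzA : z.rep A ≠ 0) (hzB : z.rep B ≠ 0) :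
    A = B := by
  by_contra hne
  have hr : Set.range A.col ≠ Set.range B.col := fun h => hne (PluckerIndex.eq_of_range_col_eq h)
  let T := symmDiff (Set.range A.col) (Set.range B.col)
  have hT : T.Nonempty := by
    rw [Set.nonempty_iff_ne_empty]
    intro h
    exact hr (symmDiff_eq_bot.1 h)
  -- The heaviest column of the symmetric difference lies in just one of `A` and `B`, and the
  -- exchange is made from that side.
  obtain ⟨t, ht, hmax⟩ := Set.exists_max_image T (colWeight m) (Set.toFinite T) hT
  rcases ht with ⟨⟨i, rfl⟩, h2⟩ | ⟨⟨i, rfl⟩, h2⟩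
  · exact mul_ne_zero hzA hzB (mul_eq_zero_of_max_mem hm hpos hz hA h2 fun j hj =>
      hmax _ (Or.inr ⟨⟨j, rfl⟩, hj⟩))
  · exact mul_ne_zero hzB hzA (mul_eq_zero_of_max_mem hm hpos hz hB h2 fun j hj =>
      hmax _ (Or.inl ⟨⟨j, rfl⟩, hj⟩))

/-- The index in `Fin n` of a column of `[F₁ F₂]`. -/
def colIndex {n : ℕ} : Fin n ⊕ Fin n → Fin n := Sum.elim id id

/-- The columns with a nonzero Plücker coordinate of minimal weight span a Lagrangian subspace. -/
theorem bijective_colIndex_of_minimal_weight {n : ℕ} {m : Fin n → ℕ} (hm : Function.Injective m)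
    (hpos : ∀ i, 0 < m i) {z : PluckerSpace n} (hz : z ∈ LG n) {A : PluckerIndex n}
    (hA : ∀ S, z.rep S ≠ 0 → A.weight m ≤ S.weight m) (hzA : z.rep A ≠ 0) :
    Function.Bijective fun a => colIndex (A.col a) := by
  have key : ∀ p q i, A.col p = Sum.inl i → A.col q = Sum.inr i → False := by
    intro p q i hp hq
    have hpq : p ≠ q := by
      rintro rfl
      rw [hp] at hq
      cases hq
    -- If both columns with index `i` occur in `A`, the term `j = i` is the coordinate at `A`. Each
    -- other term replaces them by a pair that also has total weight zero, so if nonzero it would be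
    -- a second coordinate of minimal weight. The relation then forces the coordinate at `A` to
    -- vanish.
    have h0 := LG_isotropic hz A.col hpq
    rw [Finset.sum_eq_single i] at h0
    · rw [← hp, ← hq, Function.update_eq_self, Function.update_eq_self, tupleCoord_col] at h0
      exact hzA h0
    · intro j _ hji
      by_contra hne
      obtain ⟨S, hS, hw, hr, hinj⟩ := exists_weight_eq_of_tupleCoord_ne_zero m hne
      have hsum : ∑ a, colWeight m (Function.update (Function.update A.col p (Sum.inl j)) q
          (Sum.inr j) a) = A.weight m := by
        rw [PluckerIndex.weight, ← Finset.add_sum_erase _ _ (Finset.mem_univ q),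
          ← Finset.add_sum_erase _ _ (Finset.mem_erase.2 ⟨hpq, Finset.mem_univ p⟩),
          ← Finset.add_sum_erase _ (fun a => colWeight m (A.col a)) (Finset.mem_univ q),
          ← Finset.add_sum_erase _ (fun a => colWeight m (A.col a))
            (Finset.mem_erase.2 ⟨hpq, Finset.mem_univ p⟩)]
        have : ∀ a ∈ (Finset.univ.erase q).erase p, colWeight m
            (Function.update (Function.update A.col p (Sum.inl j)) q (Sum.inr j) a) =
            colWeight m (A.col a) := by
          intro a ha
          simp only [Finset.mem_erase] at ha
          simp [ha.1, ha.2.1]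
        rw [Finset.sum_congr rfl this]
        simp [hpq, hp, hq, colWeight]
      have hSA : S = A := by
        refine eq_of_minimal_weight hm hpos hz (fun T hT => ?_) hA hS hzA
        rw [hw, hsum]
        exact hA T hT
      have hmem : Sum.inl i ∈ Set.range S.col := hSA ▸ ⟨p, hp⟩
      rw [hr] at hmem
      obtain ⟨b, hb⟩ := hmem
      by_cases hbq : b = q
      · subst hbq; simp at hb
      · by_cases hbp : b = p
        · subst hbp
          simp only [ne_eq, hpq, not_false_eq_true, Function.update_of_ne, Function.update_self,
            Sum.inl.injEq] at hb
          exact hji hb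
        · simp only [ne_eq, hbq, not_false_eq_true, Function.update_of_ne, hbp] at hb
          exact hbp (A.col_injective (hb.trans hp.symm))
    · simp
  rw [← Finite.injective_iff_bijective]
  intro a b hab
  apply A.col_injective
  rcases ha : A.col a with i | i <;> rcases hb : A.col b with j | j <;>
    simp only [colIndex, ha, hb, Sum.elim_inl, Sum.elim_inr, id] at hab <;> subst hab
  · rfl
  · exact (key _ _ _ ha hb).elim
  · exact (key _ _ _ hb ha).elim
  · rfl

/-! ### A nondegenerate diagonal transfer function -/

open Polynomial

/-- The rows of `[D N]` followed by the standard basis vectors with indices in `S`. -/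
def borderedMatrix {R : Type*} [CommRing R] {n : ℕ} (D N : Matrix (Fin n) (Fin n) R)
    (S : PluckerIndex n) : Matrix (Fin n ⊕ Fin n) (Fin n ⊕ Fin n) R :=
  Matrix.fromRows (Matrix.fromCols D N)
    (Matrix.of fun (a : Fin n) (c : Fin n ⊕ Fin n) => if S.col a = c then (1 : R) else 0)

theorem cofactor_eq_det {n : ℕ} (D N : Matrix (Fin n) (Fin n) ℂ[X]) (S : PluckerIndex n) :
    cofactor D N S = (borderedMatrix D N S).det := rfl

theorem map_borderedMatrix {R R' : Type*} [CommRing R] [CommRing R'] (f : R →+* R') {n : ℕ}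
    (D N : Matrix (Fin n) (Fin n) R) (S : PluckerIndex n) :
    (borderedMatrix D N S).map f = borderedMatrix (D.map f) (N.map f) S := by
  ext (i | i) (j | j) <;> simp [borderedMatrix, apply_ite f]

/-- The determinant of `[I I]` bordered by the basis vectors with indices in `S` is not zero exactly
for the Lagrangian coordinate subspaces. -/
theorem det_borderedMatrix_one_one_ne_zero_iff {n : ℕ} (S : PluckerIndex n) :
    (borderedMatrix (1 : Matrix (Fin n) (Fin n) ℂ) 1 S).det ≠ 0 ↔
      Function.Bijective fun a => colIndex (S.col a) := by
  have hdet : (borderedMatrix (1 : Matrix (Fin n) (Fin n) ℂ) 1 S).det =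
      (Matrix.of fun a i => (if S.col a = Sum.inr i then (1 : ℂ) else 0) -
        if S.col a = Sum.inl i then 1 else 0).det := by
    have : borderedMatrix (1 : Matrix (Fin n) (Fin n) ℂ) 1 S = Matrix.fromBlocks 1 1
        (Matrix.of fun a i => if S.col a = Sum.inl i then (1 : ℂ) else 0)
        (Matrix.of fun a i => if S.col a = Sum.inr i then (1 : ℂ) else 0) := by
      ext (i | i) (j | j) <;> simp [borderedMatrix]
    rw [this, Matrix.det_fromBlocks_one₁₁, Matrix.mul_one]
    rfl
  rw [hdet, ← Finite.surjective_iff_bijective]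
  constructor
  · intro h i
    by_contra! hi
    apply h
    apply Matrix.det_eq_zero_of_column_eq_zero i
    intro a
    have h1 : S.col a ≠ Sum.inr i := fun h => hi a (by simp [h, colIndex])
    have h2 : S.col a ≠ Sum.inl i := fun h => hi a (by simp [h, colIndex])
    simp [h1, h2]
  · intro h h0
    obtain ⟨v, hv, hMv⟩ := Matrix.exists_mulVec_eq_zero_iff.2 h0
    apply hv
    ext i
    obtain ⟨a, ha⟩ := h i
    have h3 := congrFun hMv a
    rcases hc : S.col a with j | j <;> simp only [colIndex, hc, Sum.elim_inl, Sum.elim_inr, id] at ha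
      <;> subst ha <;>
      simpa [Matrix.mulVec, dotProduct, hc, sub_mul] using h3

/-- The exponent of the variable in the scaling of the lower rows that makes the upper rows
constant. -/
def PluckerIndex.leftWeight {n : ℕ} (m : Fin n → ℕ) (S : PluckerIndex n) : ℕ :=
  ∑ a, Sum.elim m 0 (S.col a)

/-- Scaling the lower rows by powers of `X` lets `X ^ m i` be pulled out of the left columns, which
turns `[diag(X ^ m i) I]` into `[I I]`. Each cofactor is thus a constant times a power of `X`. -/
theorem cofactor_diagonal_mul {n : ℕ} (m : Fin n → ℕ) (S : PluckerIndex n) :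
    cofactor (Matrix.diagonal fun i => (X : ℂ[X]) ^ m i) 1 S * X ^ S.leftWeight m =
      C (borderedMatrix (1 : Matrix (Fin n) (Fin n) ℂ) 1 S).det * X ^ ∑ i, m i := by
  have hmat : Matrix.diagonal (Sum.elim (fun _ => (1 : ℂ[X])) fun a => X ^ Sum.elim m 0 (S.col a)) *
      borderedMatrix (Matrix.diagonal fun i => (X : ℂ[X]) ^ m i) 1 S =
      (borderedMatrix (1 : Matrix (Fin n) (Fin n) ℂ[X]) 1 S) *
        Matrix.diagonal (Sum.elim (fun i => (X : ℂ[X]) ^ m i) 1) := by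
    ext1 i j
    rw [Matrix.diagonal_mul, Matrix.mul_diagonal]
    rcases i with i | i <;> rcases j with j | j
    · by_cases h : i = j
      · subst h; simp [borderedMatrix]
      · simp [borderedMatrix, h]
    · simp [borderedMatrix]
    · by_cases h : S.col i = Sum.inl j <;> simp [borderedMatrix, h]
    · by_cases h : S.col i = Sum.inr j <;> simp [borderedMatrix, h]
  have h := congrArg Matrix.det hmat
  rw [Matrix.det_mul, Matrix.det_mul, Matrix.det_diagonal, Matrix.det_diagonal] at h
  simp only [Fintype.prod_sum_type, Sum.elim_inl, Sum.elim_inr, Finset.prod_const_one, one_mul,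
    Pi.one_apply, mul_one, Finset.prod_pow_eq_pow_sum] at h
  rw [RingHom.map_det, RingHom.mapMatrix_apply, map_borderedMatrix]
  rw [cofactor_eq_det, mul_comm]
  simpa [PluckerIndex.leftWeight] using h

/-- A Lagrangian index takes one of the two columns for each `i`, so its weight is `∑ ± m i`.
Consequently the weight and the exponent of the cofactor determine each other. -/
theorem weight_eq_of_bijective {n : ℕ} (m : Fin n → ℕ) {S : PluckerIndex n}
    (hS : Function.Bijective fun a => colIndex (S.col a)) :
    S.weight m + 2 * S.leftWeight m = ∑ i, m i := by
  have h1 : ∑ i, (m i : ℤ) = ∑ a, (m (colIndex (S.col a)) : ℤ) :=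
    (hS.sum_comp fun i => (m i : ℤ)).symm
  push_cast [PluckerIndex.weight, PluckerIndex.leftWeight]
  rw [h1, Finset.mul_sum, ← Finset.sum_add_distrib]
  refine Finset.sum_congr rfl fun a _ => ?_
  rcases S.col a with i | i <;> simp [colWeight, colIndex]
  ring

theorem leftWeight_le_of_bijective {n : ℕ} (m : Fin n → ℕ) {S : PluckerIndex n}
    (hS : Function.Bijective fun a => colIndex (S.col a)) : S.leftWeight m ≤ ∑ i, m i := by
  rw [← hS.sum_comp m]
  refine Finset.sum_le_sum fun a _ => ?_
  rcases S.col a with i | i <;> simp [colIndex]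

/-- At the exponent of `X` that belongs to the nonzero coordinate of least weight, any other
contribution would come from a Lagrangian index of the same weight, which `eq_of_minimal_weight`
excludes. That coefficient of the form is therefore nonzero. -/
theorem center_diagonal_inter_LG {n : ℕ} {m : Fin n → ℕ} (hm : Function.Injective m)
    (hpos : ∀ i, 0 < m i) :
    center (Matrix.diagonal fun i => (X : ℂ[X]) ^ m i) 1 ∩ LG n = ∅ := by
  rw [Set.eq_empty_iff_forall_notMem]
  rintro z ⟨hzc, hz⟩
  obtain ⟨A, hzA, hA⟩ : ∃ A, z.rep A ≠ 0 ∧ ∀ S, z.rep S ≠ 0 → A.weight m ≤ S.weight m := by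
    obtain ⟨S, hS⟩ := Function.ne_iff.1 z.rep_nonzero
    obtain ⟨A, h1, h2⟩ := Set.exists_min_image {S | z.rep S ≠ 0} (PluckerIndex.weight m)
      (Set.toFinite _) ⟨S, hS⟩
    exact ⟨A, h1, h2⟩
  have hbij := bijective_colIndex_of_minimal_weight hm hpos hz hA hzA
  have hcA := (det_borderedMatrix_one_one_ne_zero_iff A).2 hbij
  have hcof : ∀ S, cofactor (Matrix.diagonal fun i => (X : ℂ[X]) ^ m i) 1 S =
      C (borderedMatrix (1 : Matrix (Fin n) (Fin n) ℂ) 1 S).det * X ^ (∑ i, m i - S.leftWeight m) := by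
    intro S
    have h := cofactor_diagonal_mul m S
    apply mul_right_cancel₀ (pow_ne_zero (S.leftWeight m) (X_ne_zero (R := ℂ)))
    rw [h]
    by_cases hS : (borderedMatrix (1 : Matrix (Fin n) (Fin n) ℂ) 1 S).det = 0
    · simp [hS]
    · rw [mul_assoc, ← pow_add, Nat.sub_add_cancel]
      exact leftWeight_le_of_bijective m ((det_borderedMatrix_one_one_ne_zero_iff S).1 hS)
  have h0 := congrArg (fun p : ℂ[X] => p.coeff (∑ i, m i - A.leftWeight m)) hzc
  simp only [finsetSum_coeff, coeff_zero] at h0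
  rw [Finset.sum_eq_single A] at h0
  · rw [hcof, coeff_mul_C, coeff_C_mul, coeff_X_pow_self, mul_one] at h0
    exact mul_ne_zero hcA hzA h0
  · intro S _ hSA
    by_contra hne
    rw [hcof, coeff_mul_C, coeff_C_mul, coeff_X_pow] at hne
    have hzS := right_ne_zero_of_mul hne
    have hbS := (det_borderedMatrix_one_one_ne_zero_iff S).1
      (left_ne_zero_of_mul (left_ne_zero_of_mul hne))
    have hw : ∑ i, m i - A.leftWeight m = ∑ i, m i - S.leftWeight m := by
      by_contra h
      simp [h] at hne
    have e1 := leftWeight_le_of_bijective m hbS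
    have e2 := leftWeight_le_of_bijective m hbij
    have e3 := weight_eq_of_bijective m hbS
    have e4 := weight_eq_of_bijective m hbij
    apply hSA
    refine eq_of_minimal_weight hm hpos hz (fun T hT => ?_) hA hzS hzA
    have := hA T hT
    omega
  · simp

/-- The transfer function with entries `s^(-m_i)` on the diagonal. -/
def diagonalTransfer {n : ℕ} (m : Fin n → ℕ) : Matrix (Fin n) (Fin n) (RatFunc ℂ) :=
  Matrix.diagonal fun i => (RatFunc.X ^ m i)⁻¹

theorem isNondegenerate_diagonalTransfer {n : ℕ} {m : Fin n → ℕ} (hm : Function.Injective m)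
    (hpos : ∀ i, 0 < m i) : IsNondegenerate (diagonalTransfer m) := by
  refine ⟨Matrix.diagonal fun i => (X : ℂ[X]) ^ m i, 1, ⟨?_, ?_, 0, 1, ?_⟩,
    center_diagonal_inter_LG hm hpos⟩
  · rw [Matrix.det_diagonal]
    exact Finset.prod_ne_zero_iff.2 fun i _ => pow_ne_zero _ X_ne_zero
  · symm
    rw [Matrix.map_one _ (map_zero _) (map_one _), Matrix.mul_one]
    apply Matrix.inv_eq_right_inv
    rw [Matrix.diagonal_map (map_zero _), diagonalTransfer, Matrix.diagonal_mul_diagonal]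
    rw [← Matrix.diagonal_one]
    congr 1
    ext1 i
    simp [RatFunc.algebraMap_X, RatFunc.X_ne_zero]
  · simp

/-! ### Substitution in rational functions and the expansion at infinity -/

section Expansion

variable {F : Type*} [Field F]

theorem eval₂_C_injective {g : RatFunc F} (hg : Transcendental F g) :
    Function.Injective (Polynomial.eval₂RingHom RatFunc.C g) := by
  have := transcendental_iff_injective.1 hg
  exact this

/-- The substitution of a transcendental element as a ring homomorphism. -/
def substHom (g : RatFunc F) (hg : Transcendental F g) : RatFunc F →+* RatFunc F :=
  RatFunc.liftRingHom (Polynomial.eval₂RingHom RatFunc.C g)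
    (nonZeroDivisors_le_comap_nonZeroDivisors_of_injective _ (eval₂_C_injective hg))

/-- `RatFunc.eval` respects the ring operations only while no denominator evaluates to zero;
transcendence of `g` guarantees this. -/
theorem eval_eq_substHom {g : RatFunc F} (hg : Transcendental F g) (f : RatFunc F) :
    RatFunc.eval RatFunc.C g f = substHom g hg f := by
  conv_rhs => rw [← RatFunc.num_div_denom f]
  rw [substHom, RatFunc.liftRingHom_apply_div]
  rfl

theorem substHom_C {g : RatFunc F} (hg : Transcendental F g) (a : F) :
    substHom g hg (RatFunc.C a) = RatFunc.C a := by
  rw [← eval_eq_substHom, RatFunc.eval_C]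

theorem substHom_X {g : RatFunc F} (hg : Transcendental F g) : substHom g hg RatFunc.X = g := by
  rw [← eval_eq_substHom, RatFunc.eval_X]

theorem transcendental_neg_X : Transcendental F (-RatFunc.X : RatFunc F) := fun h =>
  RatFunc.transcendental_X (K := F) (by simpa using h.neg)

theorem transcendental_X_inv : Transcendental F (RatFunc.X⁻¹ : RatFunc F) := fun h =>
  RatFunc.transcendental_X (K := F) (by simpa using h.inv)

open scoped RatFunc in
/-- The expansion at infinity `f(1/t)` of a rational function. -/
def expandHom : RatFunc F →+* LaurentSeries F :=
  (algebraMap (RatFunc F) (LaurentSeries F)).comp (substHom RatFunc.X⁻¹ transcendental_X_inv)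

theorem expandHom_injective : Function.Injective (expandHom (F := F)) := RingHom.injective _

open scoped RatFunc in
theorem expandHom_C (a : F) : expandHom (RatFunc.C a) = HahnSeries.C a := by
  rw [expandHom, RingHom.comp_apply, substHom_C]
  have := RatFunc.coe_coe (F := F) (Polynomial.C a)
  rw [RatFunc.coePolynomial_eq_algebraMap, RatFunc.algebraMap_C] at this
  rw [← this]
  simp

open scoped RatFunc in
theorem expandHom_X : expandHom (RatFunc.X : RatFunc F) = (HahnSeries.single 1 1)⁻¹ := by
  rw [expandHom, RingHom.comp_apply, substHom_X, map_inv₀, RatFunc.coe_X]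

/-- The power series `∑ A^k t^k`. -/
def resolventSeries {κ : Type*} [Fintype κ] [DecidableEq κ] (A : Matrix κ κ F) :
    Matrix κ κ (PowerSeries F) :=
  Matrix.of fun i j => PowerSeries.mk fun k => (A ^ k) i j

theorem one_sub_mul_resolventSeries {κ : Type*} [Fintype κ] [DecidableEq κ] (A : Matrix κ κ F) :
    (1 - (PowerSeries.X : PowerSeries F) • A.map (PowerSeries.C (R := F))) * resolventSeries A
      = 1 := by
  ext i j k
  rw [sub_mul, one_mul, Matrix.sub_apply, Matrix.smul_mul, Matrix.smul_apply, smul_eq_mul, map_sub]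
  rcases k with _ | k
  · rw [PowerSeries.coeff_zero_X_mul, sub_zero]
    simp [resolventSeries, Matrix.one_apply, apply_ite]
  · rw [PowerSeries.coeff_succ_X_mul, Matrix.mul_apply, map_sum]
    have : (PowerSeries.coeff (k + 1)) ((1 : Matrix κ κ (PowerSeries F)) i j) = 0 := by
      rw [Matrix.one_apply]
      split_ifs <;> simp [PowerSeries.coeff_one]
    rw [this, sub_eq_zero]
    simp [resolventSeries, pow_succ', Matrix.mul_apply]

/-- The power series `∑ C A^k B t^(k+1)`. -/
def realizationSeries {κ ν : Type*} [Fintype κ] [DecidableEq κ] (A : Matrix κ κ F)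
    (B : Matrix κ ν F) (C : Matrix ν κ F) : Matrix ν ν (PowerSeries F) :=
  Matrix.of fun i j => PowerSeries.X * PowerSeries.mk fun k => (C * A ^ k * B) i j

theorem realizationSeries_eq {κ ν : Type*} [Fintype κ] [DecidableEq κ] (A : Matrix κ κ F)
    (B : Matrix κ ν F) (C : Matrix ν κ F) :
    realizationSeries A B C = (PowerSeries.X : PowerSeries F) •
      (C.map (PowerSeries.C (R := F)) * resolventSeries A * B.map (PowerSeries.C (R := F))) := by
  ext1 i j
  simp only [realizationSeries, Matrix.of_apply, Matrix.smul_apply, smul_eq_mul]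
  congr 1
  ext k
  simp [Matrix.mul_apply, resolventSeries, PowerSeries.coeff_mul_C, PowerSeries.coeff_C_mul]

/-- With `s = 1/t` the matrix `s I - A` becomes `t⁻¹ (I - t A)`, which the geometric series inverts.
The existence of this inverse already shows that the determinant is nonzero. -/
theorem isUnit_det_and_map_inv {d : ℕ} (A : Matrix (Fin d) (Fin d) F) :
    IsUnit (Matrix.scalar (Fin d) (RatFunc.X : RatFunc F) - A.map RatFunc.C).det ∧
    ((Matrix.scalar (Fin d) (RatFunc.X : RatFunc F) - A.map RatFunc.C)⁻¹).map expandHom =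
      (HahnSeries.single (1 : ℤ) (1 : F) : LaurentSeries F) •
        (resolventSeries A).map (HahnSeries.ofPowerSeries ℤ F) := by
  set M := Matrix.scalar (Fin d) (RatFunc.X : RatFunc F) - A.map RatFunc.C with hM
  set t : LaurentSeries F := HahnSeries.single (1 : ℤ) (1 : F) with ht
  have ht0 : t ≠ 0 := by simp [ht]
  have hmap : M.map expandHom = Matrix.scalar (Fin d) t⁻¹ - A.map HahnSeries.C := by
    ext1 i j
    simp only [hM, Matrix.map_apply, Matrix.sub_apply, map_sub, expandHom_C]
    congr 1
    rw [Matrix.scalar_apply, Matrix.scalar_apply, Matrix.diagonal_apply, Matrix.diagonal_apply]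
    split_ifs
    · exact expandHom_X
    · exact map_zero _
  have hR : (1 - t • A.map (HahnSeries.C (R := F))) *
      (resolventSeries A).map (HahnSeries.ofPowerSeries ℤ F) = 1 := by
    have h := congrArg (fun N => (HahnSeries.ofPowerSeries ℤ F).mapMatrix N)
      (one_sub_mul_resolventSeries A)
    simp only [map_mul, map_one, map_sub] at h
    convert h using 2
    · congr 1
      ext1 i j
      simp [ht]
    · rfl
  have hmul : M.map expandHom * (t • (resolventSeries A).map (HahnSeries.ofPowerSeries ℤ F)) =
      1 := by
    rw [← hR, Matrix.mul_smul, ← Matrix.smul_mul, hmap, smul_sub]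
    congr 2
    rw [← Matrix.diagonal_one, Matrix.scalar_apply, ← Matrix.diagonal_smul]
    congr 1
    ext1 i
    simp [ht0]
  have hunit : IsUnit M.det := by
    rw [isUnit_iff_ne_zero]
    intro h0
    have h1 := congrArg Matrix.det hmul
    rw [Matrix.det_mul, ← RingHom.mapMatrix_apply, ← RingHom.map_det, h0, map_zero, zero_mul,
      Matrix.det_one] at h1
    exact zero_ne_one h1
  refine ⟨hunit, ?_⟩
  have h2 : (M⁻¹).map expandHom * M.map expandHom = 1 := by
    rw [← Matrix.map_mul, Matrix.nonsing_inv_mul _ hunit,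
      Matrix.map_one _ (map_zero _) (map_one _)]
  exact left_inv_eq_right_inv h2 hmul

/-- The expansion at infinity of `C (s I - A)⁻¹ B`. -/
theorem map_expandHom_of_eq {n d : ℕ} {G : Matrix (Fin n) (Fin n) (RatFunc F)}
    {A : Matrix (Fin d) (Fin d) F} {B : Matrix (Fin d) (Fin n) F} {C : Matrix (Fin n) (Fin d) F}
    (h : G = C.map RatFunc.C *
      (Matrix.scalar (Fin d) (RatFunc.X : RatFunc F) - A.map RatFunc.C)⁻¹ * B.map RatFunc.C) :
    G.map expandHom = (realizationSeries A B C).map (HahnSeries.ofPowerSeries ℤ F) := by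
  have hC : ∀ {κ ν : Type} (N : Matrix κ ν F),
      (N.map RatFunc.C).map expandHom = N.map (HahnSeries.C (R := F) (Γ := ℤ)) := by
    intro κ ν N
    ext1 i j
    simp [expandHom_C]
  have hC' : ∀ {κ ν : Type} (N : Matrix κ ν F),
      (N.map (PowerSeries.C (R := F))).map (HahnSeries.ofPowerSeries ℤ F) =
        N.map (HahnSeries.C (R := F) (Γ := ℤ)) := by
    intro κ ν N
    ext1 i j
    simp
  rw [h, Matrix.map_mul, Matrix.map_mul, (isUnit_det_and_map_inv A).2, realizationSeries_eq, hC, hC]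
  rw [Matrix.mul_smul, Matrix.smul_mul, ← hC', ← hC', ← Matrix.map_mul, ← Matrix.map_mul]
  ext1 i j
  simp only [Matrix.smul_apply, Matrix.map_apply, smul_eq_mul, map_mul,
    HahnSeries.ofPowerSeries_X]

theorem ofPowerSeries_coeff_succ (f : PowerSeries F) (k : ℕ) :
    (HahnSeries.ofPowerSeries ℤ F f).coeff ((k : ℤ) + 1) = PowerSeries.coeff (k + 1) f := by
  have : (k : ℤ) + 1 = ((k + 1 : ℕ) : ℤ) := by push_cast; rfl
  rw [this, HahnSeries.ofPowerSeries_apply_coeff]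

end Expansion

theorem subst_eq_substHom {g : RatFunc ℂ} (hg : Transcendental ℂ g) (f : RatFunc ℂ) :
    subst f g = substHom g hg f :=
  eval_eq_substHom hg f

theorem markovCoeff_eq (f : RatFunc ℂ) (k : ℕ) :
    markovCoeff f k = (expandHom f).coeff ((k : ℤ) + 1) := by
  rw [markovCoeff, subst_eq_substHom transcendental_X_inv]
  rfl

theorem map_expandHom_of_isRealization {n d : ℕ} {G : Matrix (Fin n) (Fin n) (RatFunc ℂ)}
    {A : Matrix (Fin d) (Fin d) ℂ} {B : Matrix (Fin d) (Fin n) ℂ} {C : Matrix (Fin n) (Fin d) ℂ}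
    (h : IsRealization G A B C) :
    G.map expandHom = (realizationSeries A B C).map (HahnSeries.ofPowerSeries ℤ ℂ) :=
  map_expandHom_of_eq h

theorem realizationSeries_inj {κ κ' ν : Type*} [Fintype κ] [DecidableEq κ] [Fintype κ']
    [DecidableEq κ'] {A : Matrix κ κ ℂ} {B : Matrix κ ν ℂ} {C : Matrix ν κ ℂ}
    {A' : Matrix κ' κ' ℂ} {B' : Matrix κ' ν ℂ} {C' : Matrix ν κ' ℂ} :
    realizationSeries A B C = realizationSeries A' B' C' ↔
      ∀ k, C * A ^ k * B = C' * A' ^ k * B' := by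
  constructor
  · intro h k
    ext i j
    have := congrArg (PowerSeries.coeff (k + 1)) (congrFun (congrFun h i) j)
    simpa [realizationSeries, PowerSeries.coeff_succ_X_mul] using this
  · intro h
    ext1 i j
    simp [realizationSeries, h]

/-- Realizations of the same transfer function have the same Markov parameters, and conversely. -/
theorem isRealization_iff_of_isRealization {n d d' : ℕ} {G : Matrix (Fin n) (Fin n) (RatFunc ℂ)}
    {A : Matrix (Fin d) (Fin d) ℂ} {B : Matrix (Fin d) (Fin n) ℂ} {C : Matrix (Fin n) (Fin d) ℂ}
    (h : IsRealization G A B C) {A' : Matrix (Fin d') (Fin d') ℂ} {B' : Matrix (Fin d') (Fin n) ℂ}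
    {C' : Matrix (Fin n) (Fin d') ℂ} :
    IsRealization G A' B' C' ↔ ∀ k, C * A ^ k * B = C' * A' ^ k * B' := by
  rw [← realizationSeries_inj]
  constructor
  · intro h'
    have h2 := map_expandHom_of_isRealization h
    rw [map_expandHom_of_isRealization h'] at h2
    exact (Matrix.map_injective HahnSeries.ofPowerSeries_injective h2).symm
  · intro h'
    have h2 := map_expandHom_of_isRealization h
    -- The triple `(A', B', C')` realizes its own transfer function by `rfl`; the injective
    -- expansion identifies that function with `G`.
    rw [h', ← map_expandHom_of_isRealization (A := A') (B := B') (C := C') rfl] at h2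
    exact Matrix.map_injective expandHom_injective h2

theorem markovMap_of_isRealization {n d : ℕ} {G : Matrix (Fin n) (Fin n) (RatFunc ℂ)}
    {A : Matrix (Fin d) (Fin d) ℂ} {B : Matrix (Fin d) (Fin n) ℂ} {C : Matrix (Fin n) (Fin d) ℂ}
    (h : IsRealization G A B C) (δ : ℕ) (x : Fin (2 * δ) × Fin n × Fin n) :
    markovMap δ G x = (C * A ^ (x.1 : ℕ) * B) x.2.1 x.2.2 := by
  have h1 := congrFun (congrFun (map_expandHom_of_isRealization h) x.2.1) x.2.2
  rw [Matrix.map_apply, Matrix.map_apply] at h1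
  rw [markovMap, markovCoeff_eq, h1]
  rw [ofPowerSeries_coeff_succ]
  simp [realizationSeries, PowerSeries.coeff_succ_X_mul]

/-! ### Transfer functions with a realization are strictly proper -/

section StrictlyProper

open scoped Classical in
theorem degree_num_lt_of_inftyValuation_lt_one {f : RatFunc ℂ}
    (h : RatFunc.inftyValuation ℂ f < 1) : f.num.degree < f.denom.degree := by
  by_cases hf : f = 0
  · subst hf; simp
  · rw [RatFunc.inftyValuation_apply, RatFunc.inftyValuation_of_nonzero _ hf,
      ← WithZero.exp_zero, WithZero.exp_lt_exp, RatFunc.intDegree] at h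
    rw [Polynomial.degree_eq_natDegree (RatFunc.num_ne_zero hf),
      Polynomial.degree_eq_natDegree f.denom_ne_zero]
    exact_mod_cast (by omega : f.num.natDegree < f.denom.natDegree)

open scoped Classical in
theorem inftyValuation_C_le (a : ℂ) : RatFunc.inftyValuation ℂ (RatFunc.C a) ≤ 1 := by
  by_cases ha : a = 0
  · simp [ha]
  · exact (RatFunc.inftyValuation.C ℂ ha).le

-- Let `M = s I - A`, so that `s M⁻¹ = 1 + A M⁻¹`. If the greatest valuation in a column of `M⁻¹`
-- were at least 1, multiplication by `s` could not increase it, yet `s` has valuation greater than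
-- 1.
open scoped Classical in
theorem inftyValuation_resolvent_lt_one {d : ℕ} (A : Matrix (Fin d) (Fin d) ℂ) (i j : Fin d) :
    RatFunc.inftyValuation ℂ
      ((Matrix.scalar (Fin d) (RatFunc.X : RatFunc ℂ) - A.map RatFunc.C)⁻¹ i j) < 1 := by
  set M := Matrix.scalar (Fin d) (RatFunc.X : RatFunc ℂ) - A.map RatFunc.C with hM
  let v := RatFunc.inftyValuation ℂ
  obtain ⟨l, -, hl⟩ := Finset.exists_max_image Finset.univ (fun i => v (M⁻¹ i j)) ⟨i, by simp⟩
  refine (hl i (by simp)).trans_lt ?_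
  by_contra! hge
  have h1 := congrFun (congrFun (Matrix.mul_nonsing_inv M (isUnit_det_and_map_inv A).1) l) j
  rw [hM, sub_mul, ← hM, Matrix.sub_apply, Matrix.scalar_apply, Matrix.diagonal_mul,
    sub_eq_iff_eq_add] at h1
  have h2 : v (RatFunc.X * M⁻¹ l j) ≤ v (M⁻¹ l j) := by
    rw [h1]
    refine (v.map_add _ _).trans (max_le (le_trans ?_ hge) ?_)
    · rw [Matrix.one_apply]
      split_ifs <;> simp
    · rw [Matrix.mul_apply]
      refine v.map_sum_le fun k _ => ?_
      rw [map_mul]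
      exact (mul_le_mul' (inftyValuation_C_le _) (hl k (by simp))).trans (one_mul _).le
  rw [map_mul] at h2
  have h3 : v RatFunc.X = WithZero.exp 1 := RatFunc.inftyValuation.X ℂ
  have h4 : (1 : WithZero (Multiplicative ℤ)) < v RatFunc.X := by
    rw [h3, ← WithZero.exp_zero, WithZero.exp_lt_exp]
    exact one_pos
  have hpos : 0 < v (M⁻¹ l j) := lt_of_lt_of_le one_pos hge
  exact absurd h2 (not_le.2 (lt_mul_of_one_lt_left hpos h4))

theorem isStrictlyProper_of_isRealization {n d : ℕ} {G : Matrix (Fin n) (Fin n) (RatFunc ℂ)}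
    {A : Matrix (Fin d) (Fin d) ℂ} {B : Matrix (Fin d) (Fin n) ℂ} {C : Matrix (Fin n) (Fin d) ℂ}
    (h : IsRealization G A B C) : IsStrictlyProper G := by
  classical
  intro i j
  apply degree_num_lt_of_inftyValuation_lt_one
  rw [h, Matrix.mul_apply]
  refine Valuation.map_sum_lt _ one_ne_zero fun k _ => ?_
  rw [map_mul, Matrix.mul_apply]
  have h1 : RatFunc.inftyValuation ℂ (∑ l, C.map RatFunc.C i l *
      (Matrix.scalar (Fin d) (RatFunc.X : RatFunc ℂ) - A.map RatFunc.C)⁻¹ l k) < 1 := by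
    refine Valuation.map_sum_lt _ one_ne_zero fun l _ => ?_
    rw [map_mul]
    exact (mul_le_of_le_one_left' (inftyValuation_C_le _)).trans_lt
      (inftyValuation_resolvent_lt_one A l k)
  exact (mul_le_of_le_one_right' (inftyValuation_C_le _)).trans_lt h1

end StrictlyProper

/-! ### Minimal realizations -/

theorem exists_det_ne_zero_of_span_eq_top {ι : Type*} {d : ℕ} {v : ι → Fin d → ℂ}
    (hv : Submodule.span ℂ (Set.range v) = ⊤) :
    ∃ r : Fin d → ι, (Matrix.of fun a => v (r a)).det ≠ 0 := by
  obtain ⟨b, hb, hspan, hli⟩ := exists_linearIndependent ℂ (Set.range v)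
  have hspan' : Submodule.span ℂ (Set.range ((↑) : b → Fin d → ℂ)) = ⊤ := by
    rw [Subtype.range_coe, hspan, hv]
  let basis := Module.Basis.mk hli hspan'.ge
  let e : Fin d ≃ b := (Pi.basisFun ℂ (Fin d)).indexEquiv basis
  choose r hr using fun a : Fin d => hb (e a).2
  refine ⟨r, ?_⟩
  have h1 : LinearIndependent ℂ (Matrix.of fun a => v (r a)).row := by
    have : (Matrix.of fun a => v (r a)).row = ((↑) : b → Fin d → ℂ) ∘ e := by
      ext a : 1
      exact hr a
    rw [this]
    exact hli.comp _ e.injective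
  rw [Matrix.linearIndependent_rows_iff_isUnit, Matrix.isUnit_iff_isUnit_det] at h1
  exact h1.ne_zero

/-- Columns of the matrices `A^k B`. -/
def controlColumn {n d : ℕ} (A : Matrix (Fin d) (Fin d) ℂ) (B : Matrix (Fin d) (Fin n) ℂ)
    (x : ℕ × Fin n) : Fin d → ℂ :=
  (A ^ x.1 * B).col x.2

open Matrix in
/-- A realization of least dimension is controllable. -/
theorem span_controlColumn_eq_top {n d : ℕ} {G : Matrix (Fin n) (Fin n) (RatFunc ℂ)}
    {A : Matrix (Fin d) (Fin d) ℂ} {B : Matrix (Fin d) (Fin n) ℂ} {C : Matrix (Fin n) (Fin d) ℂ}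
    (h : IsRealization G A B C) (hG : HasMcMillanDegree G d) :
    Submodule.span ℂ (Set.range (controlColumn A B)) = ⊤ := by
  set V := Submodule.span ℂ (Set.range (controlColumn A B)) with hV
  let b := Module.finBasis ℂ V
  set d' := Module.finrank ℂ V
  let P : Matrix (Fin d) (Fin d') ℂ := Matrix.of fun i a => (b a : Fin d → ℂ) i
  have hP : ∀ x ∈ V, ∃ y, P *ᵥ y = x := by
    intro x hx
    refine ⟨b.repr ⟨x, hx⟩, ?_⟩
    have := congrArg Subtype.val (b.sum_repr ⟨x, hx⟩)
    simp only [Submodule.coe_sum, Submodule.coe_smul] at this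
    conv_rhs => rw [← this]
    ext i
    simp [P, Matrix.mulVec, dotProduct, Finset.sum_apply, mul_comm]
  have hcol : ∀ {k : ℕ} (N : Matrix (Fin d) (Fin k) ℂ), (∀ j, N.col j ∈ V) →
      ∃ N' : Matrix (Fin d') (Fin k) ℂ, N = P * N' := by
    intro k N hN
    choose y hy using fun j => hP _ (hN j)
    refine ⟨Matrix.of fun i j => y j i, ?_⟩
    ext i j
    exact (congrFun (hy j) i).symm
  have hA : ∀ x ∈ V, A *ᵥ x ∈ V := by
    intro x hx
    have : V ≤ V.comap (Matrix.mulVecLin A) := by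
      conv_lhs => rw [hV]
      rw [Submodule.span_le]
      rintro _ ⟨⟨k, j⟩, rfl⟩
      refine Submodule.subset_span ⟨(k + 1, j), ?_⟩
      ext i
      simp [controlColumn, pow_succ', Matrix.mul_assoc, Matrix.mul_apply, Matrix.mulVec, dotProduct]
    exact this hx
  obtain ⟨B', hB'⟩ := hcol B fun j => Submodule.subset_span ⟨(0, j), by simp [controlColumn]⟩
  obtain ⟨A', hA'⟩ := hcol (A * P) fun j => hA _ (b j).2
  have hpow : ∀ k, A ^ k * P = P * A' ^ k := by
    intro k
    induction k with
    | zero => simp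
    | succ k ih => rw [pow_succ', Matrix.mul_assoc, ih, ← Matrix.mul_assoc, hA', pow_succ',
        Matrix.mul_assoc]
  -- The controllable subspace `V` is `A`-invariant and contains the columns of `B`, so the system
  -- restricts to it without changing `G`. Minimality then leaves no room for a proper `V`.
  have hreal : IsRealization G A' B' (C * P) := by
    rw [isRealization_iff_of_isRealization h]
    intro k
    conv_lhs => rw [hB']
    rw [← Matrix.mul_assoc, Matrix.mul_assoc C, hpow, Matrix.mul_assoc C P]
  have hle : d ≤ d' := hG.2 ⟨A', B', C * P, hreal⟩
  apply Submodule.eq_top_of_finrank_eq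
  apply le_antisymm (Submodule.finrank_le V)
  simpa using hle

/-- Transposition exchanges controllability and observability, so only controllability of minimal
realizations needs a separate proof. -/
theorem isRealization_transpose {n d : ℕ} {G : Matrix (Fin n) (Fin n) (RatFunc ℂ)}
    {A : Matrix (Fin d) (Fin d) ℂ} {B : Matrix (Fin d) (Fin n) ℂ} {C : Matrix (Fin n) (Fin d) ℂ}
    (h : IsRealization G A B C) :
    IsRealization G.transpose A.transpose C.transpose B.transpose := by
  unfold IsRealization at h ⊢
  rw [h]
  simp only [Matrix.transpose_mul, Matrix.transpose_nonsing_inv, Matrix.transpose_sub,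
    Matrix.transpose_map, Matrix.mul_assoc, Matrix.scalar_apply, Matrix.diagonal_transpose]

theorem hasMcMillanDegree_transpose {n d : ℕ} {G : Matrix (Fin n) (Fin n) (RatFunc ℂ)}
    (h : HasMcMillanDegree G d) : HasMcMillanDegree G.transpose d := by
  constructor
  · obtain ⟨A, B, C, hr⟩ := h.1
    exact ⟨_, _, _, isRealization_transpose hr⟩
  · rintro d' ⟨A, B, C, hr⟩
    have := isRealization_transpose hr
    rw [Matrix.transpose_transpose] at this
    exact h.2 ⟨_, _, _, this⟩

/-! ### Hankel minors as a test for the McMillan degree. -/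

/-- A minor of the block Hankel matrix of the Markov parameters `C A^k B`. -/
def hankelMinor {R : Type*} [CommRing R] {n d e : ℕ} (A : Matrix (Fin d) (Fin d) R)
    (B : Matrix (Fin d) (Fin n) R) (C : Matrix (Fin n) (Fin d) R) (r c : Fin e → ℕ × Fin n) : R :=
  (Matrix.of fun a b => (C * A ^ ((r a).1 + (c b).1) * B) (r a).2 (c b).2).det

/-- A row tuple for which the observability matrix and a column tuple for which the controllability
matrix of a minimal realization is invertible. -/
theorem exists_invertible_of_hasMcMillanDegree {n d : ℕ} {G : Matrix (Fin n) (Fin n) (RatFunc ℂ)}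
    {A : Matrix (Fin d) (Fin d) ℂ} {B : Matrix (Fin d) (Fin n) ℂ} {C : Matrix (Fin n) (Fin d) ℂ}
    (h : IsRealization G A B C) (hG : HasMcMillanDegree G d) :
    ∃ r c : Fin d → ℕ × Fin n,
      (Matrix.of fun a i => (C * A ^ (r a).1) (r a).2 i).det ≠ 0 ∧
      (Matrix.of fun i b => (A ^ (c b).1 * B) i (c b).2).det ≠ 0 := by
  obtain ⟨c, hc⟩ := exists_det_ne_zero_of_span_eq_top (span_controlColumn_eq_top h hG)
  obtain ⟨r, hr⟩ := exists_det_ne_zero_of_span_eq_top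
    (span_controlColumn_eq_top (isRealization_transpose h) (hasMcMillanDegree_transpose hG))
  refine ⟨r, c, ?_, ?_⟩
  · convert hr using 2
    ext a i
    simp only [Matrix.of_apply, controlColumn, Matrix.col_apply]
    rw [← Matrix.transpose_pow, ← Matrix.transpose_mul, Matrix.transpose_apply]
  · rw [← Matrix.det_transpose]
    exact hc

/-- The block Hankel matrix factors through the state space as observability times controllability.
Hence a nonzero minor has size at most the state dimension, and a minimal realization attains it. -/
theorem hankelMinor_eq {R : Type*} [CommRing R] {n d e : ℕ} (A : Matrix (Fin d) (Fin d) R)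
    (B : Matrix (Fin d) (Fin n) R) (C : Matrix (Fin n) (Fin d) R) (r c : Fin e → ℕ × Fin n) :
    hankelMinor A B C r c = ((Matrix.of fun a i => (C * A ^ (r a).1) (r a).2 i) *
      (Matrix.of fun i b => (A ^ (c b).1 * B) i (c b).2)).det := by
  rw [hankelMinor]
  congr 1
  ext a b
  rw [Matrix.of_apply, pow_add, ← Matrix.mul_assoc, Matrix.mul_assoc, Matrix.mul_apply,
    Matrix.mul_apply]
  rfl

theorem exists_hankelMinor_ne_zero {n d : ℕ} {G : Matrix (Fin n) (Fin n) (RatFunc ℂ)}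
    {A : Matrix (Fin d) (Fin d) ℂ} {B : Matrix (Fin d) (Fin n) ℂ} {C : Matrix (Fin n) (Fin d) ℂ}
    (h : IsRealization G A B C) (hG : HasMcMillanDegree G d) :
    ∃ r c : Fin d → ℕ × Fin n, hankelMinor A B C r c ≠ 0 := by
  obtain ⟨r, c, hr, hc⟩ := exists_invertible_of_hasMcMillanDegree h hG
  refine ⟨r, c, ?_⟩
  rw [hankelMinor_eq, Matrix.det_mul]
  exact mul_ne_zero hr hc

theorem le_of_hankelMinor_ne_zero {n d e : ℕ} {A : Matrix (Fin d) (Fin d) ℂ}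
    {B : Matrix (Fin d) (Fin n) ℂ} {C : Matrix (Fin n) (Fin d) ℂ} {r c : Fin e → ℕ × Fin n}
    (h : hankelMinor A B C r c ≠ 0) : e ≤ d := by
  rw [hankelMinor_eq] at h
  have h0 := (Matrix.isUnit_iff_isUnit_det _).2 h.isUnit
  have h1 := Matrix.rank_of_isUnit _ h0
  rw [Fintype.card_fin] at h1
  rw [← h1]
  refine (Matrix.rank_mul_le_left _ _).trans ((Matrix.rank_le_width _))

/-- The minor depends only on the Markov parameters, so it is nonzero for every other realization as
well and bounds its dimension below by `d`. -/
theorem hasMcMillanDegree_of_hankelMinor_ne_zero {n d : ℕ}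
    {G : Matrix (Fin n) (Fin n) (RatFunc ℂ)} {A : Matrix (Fin d) (Fin d) ℂ}
    {B : Matrix (Fin d) (Fin n) ℂ} {C : Matrix (Fin n) (Fin d) ℂ} (h : IsRealization G A B C)
    {r c : Fin d → ℕ × Fin n} (hrc : hankelMinor A B C r c ≠ 0) : HasMcMillanDegree G d := by
  refine ⟨⟨A, B, C, h⟩, ?_⟩
  rintro d' ⟨A', B', C', h'⟩
  apply le_of_hankelMinor_ne_zero (A := A') (B := B') (C := C') (r := r) (c := c)
  have := (isRealization_iff_of_isRealization h).1 h'
  unfold hankelMinor at hrc ⊢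
  simpa only [this] using hrc

/-! ### Symmetries of the transfer function and of its Markov parameters -/

/-- The sequence `C A^k B` satisfies `H_kᵗ = ε^(k+1) H_k`. -/
def HasSymmetricMarkov {n d : ℕ} (ε : ℂ) (A : Matrix (Fin d) (Fin d) ℂ)
    (B : Matrix (Fin d) (Fin n) ℂ) (C : Matrix (Fin n) (Fin d) ℂ) : Prop :=
  ∀ k, (C * A ^ k * B).transpose = ε ^ (k + 1) • (C * A ^ k * B)

/-- Here `ε = 1`, and `ε = -1` in `mem_Ham_iff`: both families become instances of one symmetry of
the Markov parameters and are treated together afterwards. -/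
theorem mem_SRat_iff {n d δ : ℕ} {G : Matrix (Fin n) (Fin n) (RatFunc ℂ)}
    {A : Matrix (Fin d) (Fin d) ℂ} {B : Matrix (Fin d) (Fin n) ℂ} {C : Matrix (Fin n) (Fin d) ℂ}
    (h : IsRealization G A B C) :
    G ∈ SRat n δ ↔ HasMcMillanDegree G δ ∧ HasSymmetricMarkov 1 A B C := by
  have h1 : G.transpose = G ↔ HasSymmetricMarkov 1 A B C := by
    have h2 : G.transpose = G ↔ IsRealization G A.transpose C.transpose B.transpose :=
      ⟨fun h' => h' ▸ isRealization_transpose h, fun h' => (isRealization_transpose h).trans h'.symm⟩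
    rw [h2, isRealization_iff_of_isRealization h]
    refine forall_congr' fun k => ?_
    rw [one_pow, one_smul, eq_comm, ← Matrix.transpose_pow, ← Matrix.transpose_mul,
      ← Matrix.transpose_mul, Matrix.mul_assoc]
  simp only [SRat, Set.mem_ofPred_eq, h1, isStrictlyProper_of_isRealization h, true_and]

/-- Replacing `s` by `-s` turns `s I - A` into `-(s I + A)`; the outer sign is moved to `B`. -/
theorem isRealization_subst_neg {n d : ℕ} {G : Matrix (Fin n) (Fin n) (RatFunc ℂ)}
    {A : Matrix (Fin d) (Fin d) ℂ} {B : Matrix (Fin d) (Fin n) ℂ} {C : Matrix (Fin n) (Fin d) ℂ}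
    (h : IsRealization G A B C) :
    IsRealization (G.map fun f => subst f (-RatFunc.X)) (-A) (-B) C := by
  let σ := substHom (-RatFunc.X : RatFunc ℂ) transcendental_neg_X
  have hσ : (fun f => subst f (-RatFunc.X : RatFunc ℂ)) = σ := funext (subst_eq_substHom transcendental_neg_X)
  rw [hσ]
  have hC : ∀ {κ ν : Type} (N : Matrix κ ν ℂ), (N.map RatFunc.C).map σ = N.map RatFunc.C := by
    intro κ ν N
    ext1 i j
    simp [σ, substHom_C]
  set M := Matrix.scalar (Fin d) (RatFunc.X : RatFunc ℂ) - A.map RatFunc.C with hM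
  set M' := Matrix.scalar (Fin d) (RatFunc.X : RatFunc ℂ) - (-A).map RatFunc.C with hM'
  have hMM : M.map σ = -M' := by
    ext1 i j
    by_cases hij : i = j
    · subst hij
      simp [hM, hM', σ, substHom_X, substHom_C]
      ring
    · simp [hM, hM', σ, substHom_C, hij]
  have hinv : (M⁻¹).map σ = -M'⁻¹ := by
    have h1 : (M⁻¹).map σ * M.map σ = 1 := by
      rw [← Matrix.map_mul, Matrix.nonsing_inv_mul _ (isUnit_det_and_map_inv A).1,
        Matrix.map_one _ (map_zero _) (map_one _)]
    have h2 : M.map σ * -M'⁻¹ = 1 := by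
      rw [hMM, neg_mul_neg, Matrix.mul_nonsing_inv _ (isUnit_det_and_map_inv (-A)).1]
    exact left_inv_eq_right_inv h1 h2
  unfold IsRealization at h ⊢
  rw [h, Matrix.map_mul, Matrix.map_mul, hC, hC, hinv]
  have : (-B).map RatFunc.C = -(B.map RatFunc.C) := by
    ext1 i j
    simp
  rw [this]
  simp only [Matrix.mul_neg, Matrix.neg_mul, hM']

theorem mem_Ham_iff {n d δ : ℕ} {G : Matrix (Fin n) (Fin n) (RatFunc ℂ)}
    {A : Matrix (Fin d) (Fin d) ℂ} {B : Matrix (Fin d) (Fin n) ℂ} {C : Matrix (Fin n) (Fin d) ℂ}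
    (h : IsRealization G A B C) :
    G ∈ Ham n δ ↔ HasMcMillanDegree G δ ∧ HasSymmetricMarkov (-1) A B C := by
  have h0 := isRealization_transpose (isRealization_subst_neg h)
  have h1 : (G.map fun f => subst f (-RatFunc.X)).transpose = G ↔
      HasSymmetricMarkov (-1) A B C := by
    have h2 : (G.map fun f => subst f (-RatFunc.X)).transpose = G ↔
        IsRealization G (-A).transpose C.transpose (-B).transpose :=
      ⟨fun h' => by rwa [h'] at h0, fun h' => h0.trans h'.symm⟩
    rw [h2, isRealization_iff_of_isRealization h]
    refine forall_congr' fun k => ?_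
    rw [← Matrix.transpose_pow, ← Matrix.transpose_mul, ← Matrix.transpose_mul, ← Matrix.mul_assoc]
    have h3 : C * (-A) ^ k * -B = (-1 : ℂ) ^ (k + 1) • (C * A ^ k * B) := by
      rw [neg_pow, pow_succ]
      rcases Nat.even_or_odd k with hk | hk
      · simp [hk.neg_one_pow]
      · simp [hk.neg_one_pow]
    rw [h3, Matrix.transpose_smul]
    have h4 : (-1 : ℂ) ^ (k + 1) * (-1) ^ (k + 1) = 1 := by
      rw [← mul_pow]; simp
    constructor
    · intro h5
      have h6 := congrArg (fun N => (-1 : ℂ) ^ (k + 1) • N) h5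
      simp only [smul_smul, h4, one_smul] at h6
      exact h6.symm
    · intro h5
      rw [h5, smul_smul, h4, one_smul]
  simp only [Ham, Set.mem_ofPred_eq, h1, isStrictlyProper_of_isRealization h, true_and]

/-- The Markov parameters of `Bᵗ (s I - W S)⁻¹ W B` with `Wᵗ = ε W` and `Sᵗ = S`. -/
theorem hasSymmetricMarkov_of_transpose_eq {n d : ℕ} {ε : ℂ} {W S : Matrix (Fin d) (Fin d) ℂ}
    (hW : W.transpose = ε • W) (hS : S.transpose = S) (B : Matrix (Fin d) (Fin n) ℂ) :
    HasSymmetricMarkov ε (W * S) (W * B) B.transpose := by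
  intro k
  have key : ((W * S) ^ k * W).transpose = ε ^ (k + 1) • ((W * S) ^ k * W) := by
    induction k with
    | zero => simp [hW]
    | succ k ih =>
      rw [pow_succ', Matrix.mul_assoc, Matrix.transpose_mul, ih, Matrix.transpose_mul, hS, hW,
        Matrix.mul_smul, Matrix.mul_smul, Matrix.smul_mul, smul_smul, ← pow_succ']
      congr 1
      rw [← Matrix.mul_assoc, ← Matrix.mul_assoc, Matrix.mul_assoc ((W * S) ^ k), ← pow_succ,
        pow_succ']
  have h1 : B.transpose * (W * S) ^ k * (W * B) = B.transpose * ((W * S) ^ k * W) * B := by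
    simp only [Matrix.mul_assoc]
  rw [h1, Matrix.transpose_mul, Matrix.transpose_mul, Matrix.transpose_transpose, key,
    Matrix.smul_mul, Matrix.mul_smul, Matrix.mul_assoc, Matrix.mul_assoc, Matrix.mul_assoc]

/-- A minimal realization of a transfer function with symmetric Markov parameters can be brought to
the form `(W S, W B, Bᵗ)` with `Wᵗ = ε W` and `Sᵗ = S`. -/
theorem exists_symmetric_realization {n d : ℕ} {ε : ℂ} (hε : ε * ε = 1)
    {G : Matrix (Fin n) (Fin n) (RatFunc ℂ)} {A : Matrix (Fin d) (Fin d) ℂ}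
    {B : Matrix (Fin d) (Fin n) ℂ} {C : Matrix (Fin n) (Fin d) ℂ} (h : IsRealization G A B C)
    (hG : HasMcMillanDegree G d) (hsym : HasSymmetricMarkov ε A B C) :
    ∃ (W S : Matrix (Fin d) (Fin d) ℂ) (B' : Matrix (Fin d) (Fin n) ℂ),
      W.transpose = ε • W ∧ S.transpose = S ∧ IsRealization G (W * S) (W * B') B'.transpose := by
  obtain ⟨r, c, hr, hc⟩ := exists_invertible_of_hasMcMillanDegree h hG
  have hε2 : ∀ k, ε ^ k * ε ^ k = 1 := fun k => by rw [← mul_pow, hε, one_pow]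
  set Q : Matrix (Fin d) (Fin d) ℂ := Matrix.of fun a i => (C * A ^ (r a).1) (r a).2 i with hQ
  set P : Matrix (Fin d) (Fin d) ℂ := Matrix.of fun i b => (A ^ (c b).1 * B) i (c b).2 with hP
  have hQu : IsUnit Q.det := hr.isUnit
  let R : Matrix (Fin d) (Fin d) ℂ := Matrix.of fun i a =>
    ε ^ (r a).1 * (A ^ (r a).1 * B) i (r a).2
  let L := Q⁻¹
  have hLQ : L * Q = 1 := Matrix.nonsing_inv_mul Q hQu
  have hQL : Q * L = 1 := Matrix.mul_nonsing_inv Q hQu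
  have hQL' : Q.transpose * L.transpose = 1 := by
    rw [← Matrix.transpose_mul, hLQ, Matrix.transpose_one]
  let W := R * L.transpose
  have hsym' : ∀ k i j, (C * A ^ k * B) j i = ε ^ (k + 1) * (C * A ^ k * B) i j := fun k i j =>
    congrFun (congrFun (hsym k) i) j
  -- products of the observability rows with the state vectors
  have hCA : ∀ (k l : ℕ) (i j : Fin n),
      ∑ x, (C * A ^ l) i x * (A ^ k * B) x j = (C * A ^ (l + k) * B) i j := by
    intro k l i j
    rw [← Matrix.mul_apply, pow_add]
    simp only [Matrix.mul_assoc]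
  -- Up to powers of `ε`, the entries of `Q R` are entries of Markov parameters with indices that
  -- add. Their symmetry makes `Q R`, and with it `W`, symmetric up to the factor `ε`.
  have hQR : Q * R = ε • (R.transpose * Q.transpose) := by
    ext a b
    have e1 : (Q * R) a b =
        ε ^ (r b).1 * (C * A ^ ((r a).1 + (r b).1) * B) (r a).2 (r b).2 := by
      rw [← hCA, Finset.mul_sum, Matrix.mul_apply]
      refine Finset.sum_congr rfl fun _ _ => ?_
      simp only [hQ, R, Matrix.of_apply]
      ring
    have e2 : (R.transpose * Q.transpose) a b =
        ε ^ (r a).1 * (C * A ^ ((r b).1 + (r a).1) * B) (r b).2 (r a).2 := by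
      rw [← hCA, Finset.mul_sum, Matrix.mul_apply]
      refine Finset.sum_congr rfl fun _ _ => ?_
      simp only [hQ, R, Matrix.of_apply, Matrix.transpose_apply]
      ring
    rw [Matrix.smul_apply, smul_eq_mul, e1, e2, hsym' _ (r a).2 (r b).2, add_comm (r b).1, pow_succ ε, pow_add ε]
    linear_combination (-(ε ^ (r b).1) * (C * A ^ ((r a).1 + (r b).1) * B) (r a).2 (r b).2) *
      (ε * ε * hε2 (r a).1 + hε)
  have hcancel : ∀ {ν : Type} {x y : Matrix (Fin d) ν ℂ}, Q * x = Q * y → x = y := by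
    intro ν x y hxy
    have := congrArg (fun z => L * z) hxy
    simpa only [← Matrix.mul_assoc, hLQ, Matrix.one_mul] using this
  have hQW : Q * W = ε • R.transpose := by
    rw [← Matrix.mul_assoc, hQR, Matrix.smul_mul, Matrix.mul_assoc, hQL', Matrix.mul_one]
  have hWsym : W.transpose = ε • W := by
    apply hcancel
    rw [Matrix.mul_smul, hQW, smul_smul, hε, one_smul, Matrix.transpose_mul,
      Matrix.transpose_transpose, ← Matrix.mul_assoc, hQL, Matrix.one_mul]
  -- This relation is what determines `W`: imposed on the independent rows collected in `Q`, it
  -- reads `W Qᵗ = R`, whence `W = R (Q⁻¹)ᵗ`.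
  have hWk : ∀ k, W * (C * A ^ k).transpose = ε ^ k • (A ^ k * B) := by
    intro k
    apply hcancel
    rw [← Matrix.mul_assoc, hQW]
    ext a j
    have e1 : (Q * (A ^ k * B)) a j = (C * A ^ ((r a).1 + k) * B) (r a).2 j := by
      rw [← hCA, Matrix.mul_apply]
      rfl
    have e2 : (R.transpose * (C * A ^ k).transpose) a j =
        ε ^ (r a).1 * (C * A ^ (k + (r a).1) * B) j (r a).2 := by
      rw [← hCA, Finset.mul_sum, Matrix.mul_apply]
      refine Finset.sum_congr rfl fun _ _ => ?_
      simp only [R, Matrix.of_apply, Matrix.transpose_apply]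
      ring
    rw [Matrix.smul_mul, Matrix.smul_apply, Matrix.mul_smul, Matrix.smul_apply, smul_eq_mul,
      smul_eq_mul, e1, e2, hsym' _ (r a).2 j, add_comm k, pow_succ ε, pow_add ε]
    linear_combination (ε ^ k * (C * A ^ ((r a).1 + k) * B) (r a).2 j) *
      (ε * ε * hε2 (r a).1 + hε)
  have hAW : A * W = ε • (W * A.transpose) := by
    have h1 : ∀ a, (A * W * Q.transpose).col a = (ε • (W * A.transpose) * Q.transpose).col a := by
      intro a
      have e1 : Q.transpose.col a = (C * A ^ (r a).1).transpose.col (r a).2 := rfl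
      have e2 : ∀ N : Matrix (Fin d) (Fin d) ℂ, (N * Q.transpose).col a =
          (N * (C * A ^ (r a).1).transpose).col (r a).2 := fun N => rfl
      rw [e2, e2, Matrix.mul_assoc, hWk, Matrix.smul_mul, Matrix.mul_assoc, ← Matrix.transpose_mul,
        Matrix.mul_assoc C, ← pow_succ, hWk, Matrix.mul_smul, smul_smul, ← Matrix.mul_assoc,
        ← pow_succ', ← pow_succ', pow_succ ε, pow_succ ε, mul_assoc, hε, mul_one]
    have h2 : A * W * Q.transpose = ε • (W * A.transpose) * Q.transpose := by
      ext i a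
      exact congrFun (h1 a) i
    have h3 := congrArg (fun z => z * L.transpose) h2
    simpa only [Matrix.mul_assoc, hQL', Matrix.mul_one] using h3
  have hWB : W * C.transpose = B := by simpa using hWk 0
  -- `W` sends the scaled observability rows in `K` to the invertible controllability matrix `P`.
  have hWu : IsUnit W.det := by
    let K : Matrix (Fin d) (Fin d) ℂ := Matrix.of fun i b =>
      ε ^ (c b).1 * (C * A ^ (c b).1) (c b).2 i
    have hWK : W * K = P := by
      ext i b
      have h1 := congrFun (congrFun (hWk (c b).1) i) (c b).2
      simp only [Matrix.smul_apply, Matrix.mul_apply (M := W), Matrix.transpose_apply,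
        smul_eq_mul] at h1
      simp only [Matrix.mul_apply (M := W), K, hP, Matrix.of_apply]
      calc ∑ x, W i x * (ε ^ (c b).1 * (C * A ^ (c b).1) (c b).2 x)
          = ε ^ (c b).1 * ∑ x, W i x * (C * A ^ (c b).1) (c b).2 x := by
            rw [Finset.mul_sum]
            exact Finset.sum_congr rfl fun _ _ => by ring
        _ = _ := by rw [h1, ← mul_assoc, hε2, one_mul]
    have h2 : W.det * K.det ≠ 0 := by rwa [← Matrix.det_mul, hWK]
    exact (left_ne_zero_of_mul h2).isUnit
  have hWW : W * W⁻¹ = 1 := Matrix.mul_nonsing_inv W hWu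
  have hWW' : W⁻¹ * W = 1 := Matrix.nonsing_inv_mul W hWu
  have hA1 : W * (W⁻¹ * A) = A := by rw [← Matrix.mul_assoc, hWW, Matrix.one_mul]
  refine ⟨W, W⁻¹ * A, C.transpose, hWsym, ?_, ?_⟩
  · have h1 : W⁻¹ * A = ε • (A.transpose * W⁻¹) := by
      calc W⁻¹ * A = W⁻¹ * (A * W) * W⁻¹ := by
            rw [Matrix.mul_assoc, Matrix.mul_assoc A, hWW, Matrix.mul_one]
        _ = _ := by
            rw [hAW, Matrix.mul_smul, ← Matrix.mul_assoc W⁻¹, hWW', Matrix.one_mul, Matrix.smul_mul]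
    have h2 : W.transpose⁻¹ = ε • W⁻¹ := by
      apply Matrix.inv_eq_right_inv
      rw [hWsym, Matrix.smul_mul, Matrix.mul_smul, smul_smul, hε, one_smul, hWW]
    rw [Matrix.transpose_mul, Matrix.transpose_nonsing_inv, h2, Matrix.mul_smul, ← h1]
  · rw [hA1, hWB, Matrix.transpose_transpose]
    exact h

/-! ### Irreducibility of the spaces of transfer functions -/

/-- Basic open sets of the Zariski topology. -/
theorem exists_eval_ne_zero_of_isOpen {τ : Type} {U : Set (τ → ℂ)}
    (hU : @IsOpen _ (zariskiTopology τ) U) {x : τ → ℂ} (hx : x ∈ U) :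
    ∃ p : MvPolynomial τ ℂ, MvPolynomial.eval x p ≠ 0 ∧
      ∀ y, MvPolynomial.eval y p ≠ 0 → y ∈ U := by
  let _ := zariskiTopology τ
  obtain ⟨P, hP⟩ := (isClosed_zariskiTopology_iff τ _).1 hU.isClosed_compl
  have h1 : ¬ ∀ p ∈ P, MvPolynomial.eval x p = 0 := by
    intro h
    have : x ∈ Uᶜ := by rw [hP]; exact h
    exact this hx
  push Not at h1
  obtain ⟨p, hp, hpx⟩ := h1
  refine ⟨p, hpx, fun y hy => ?_⟩
  by_contra hyU
  have : y ∈ Uᶜ := hyU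
  rw [hP] at this
  exact hy (this p hp)

/-- The Markov parameters of `Bᵗ (s I - W S)⁻¹ W B`. -/
def symmetricMarkov {R : Type*} [CommRing R] {n d : ℕ} (δ : ℕ) (W S : Matrix (Fin d) (Fin d) R)
    (B : Matrix (Fin d) (Fin n) R) (x : Fin (2 * δ) × Fin n × Fin n) : R :=
  (B.transpose * (W * S) ^ (x.1 : ℕ) * (W * B)) x.2.1 x.2.2

theorem map_mul_pow_mul {R R' : Type*} [CommRing R] [CommRing R'] (f : R →+* R') {n d : ℕ}
    (A : Matrix (Fin d) (Fin d) R) (B : Matrix (Fin d) (Fin n) R) (C : Matrix (Fin n) (Fin d) R)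
    (k : ℕ) : (C * A ^ k * B).map f = C.map f * A.map f ^ k * B.map f := by
  have h : (A ^ k).map f = A.map f ^ k := map_pow f.mapMatrix A k
  rw [Matrix.map_mul, Matrix.map_mul, h]

theorem map_symmetricMarkov {R R' : Type*} [CommRing R] [CommRing R'] (f : R →+* R') {n d δ : ℕ}
    (W S : Matrix (Fin d) (Fin d) R) (B : Matrix (Fin d) (Fin n) R)
    (x : Fin (2 * δ) × Fin n × Fin n) :
    f (symmetricMarkov δ W S B x) = symmetricMarkov δ (W.map f) (S.map f) (B.map f) x := by
  have h := congrFun (congrFun (map_mul_pow_mul f (W * S) (W * B) B.transpose x.1) x.2.1) x.2.2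
  have e1 : (W * S).map f = W.map f * S.map f := Matrix.map_mul
  have e2 : (W * B).map f = W.map f * B.map f := Matrix.map_mul
  rw [e1, e2] at h
  exact h

theorem map_hankelMinor {R R' : Type*} [CommRing R] [CommRing R'] (f : R →+* R') {n d e : ℕ}
    (A : Matrix (Fin d) (Fin d) R) (B : Matrix (Fin d) (Fin n) R) (C : Matrix (Fin n) (Fin d) R)
    (r c : Fin e → ℕ × Fin n) :
    f (hankelMinor A B C r c) = hankelMinor (A.map f) (B.map f) (C.map f) r c := by
  rw [hankelMinor, hankelMinor, RingHom.map_det]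
  congr 1
  ext a b
  simp only [RingHom.mapMatrix_apply, Matrix.map_apply, Matrix.of_apply, ← map_mul_pow_mul]

/-- The line through two matrices. -/
def matrixLine {κ ν : Type*} (M₀ M₁ : Matrix κ ν ℂ) : Matrix κ ν (Polynomial ℂ) :=
  Matrix.of fun i j =>
    Polynomial.C (M₀ i j) + Polynomial.X * (Polynomial.C (M₁ i j) - Polynomial.C (M₀ i j))

theorem map_eval_matrixLine {κ ν : Type*} (M₀ M₁ : Matrix κ ν ℂ) (t : ℂ) :
    (matrixLine M₀ M₁).map (Polynomial.evalRingHom t) = M₀ + t • (M₁ - M₀) := by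
  ext i j
  simp [matrixLine]

theorem exists_eval_ne_zero_of_ne_zero {p : Polynomial ℂ} (hp : p ≠ 0) : ∃ t, p.eval t ≠ 0 := by
  by_contra! h
  exact hp (Polynomial.funext fun t => by simp [h t])

/-- The conditions on `(W, S, B)` are linear, so the line through triples over the two open sets
consists of admissible triples. Along it one polynomial is nonzero at `t = 0`, another at `t = 1`,
and a Hankel minor at `t = 0`. Some `t` avoids the zeros of all three; there the McMillan degree is
`δ` and the point lies in both open sets. -/
theorem preirreducibleSpace_of_symmetric {n δ : ℕ} {ε : ℂ} (hε : ε * ε = 1)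
    {𝒮 : Set (Matrix (Fin n) (Fin n) (RatFunc ℂ))}
    (h𝒮 : ∀ {G} {A : Matrix (Fin δ) (Fin δ) ℂ} {B : Matrix (Fin δ) (Fin n) ℂ}
      {C : Matrix (Fin n) (Fin δ) ℂ}, IsRealization G A B C →
        (G ∈ 𝒮 ↔ HasMcMillanDegree G δ ∧ HasSymmetricMarkov ε A B C))
    (hdeg : ∀ G ∈ 𝒮, HasMcMillanDegree G δ) :
    @PreirreducibleSpace 𝒮 (transferTopology δ 𝒮) := by
  let _ := transferTopology δ 𝒮
  have hbasic : ∀ U : Set 𝒮, IsOpen U → U.Nonempty → ∃ (W S : Matrix (Fin δ) (Fin δ) ℂ)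
      (B : Matrix (Fin δ) (Fin n) ℂ) (p : MvPolynomial (Fin (2 * δ) × Fin n × Fin n) ℂ)
      (r c : Fin δ → ℕ × Fin n), W.transpose = ε • W ∧ S.transpose = S ∧
      MvPolynomial.eval (symmetricMarkov δ W S B) p ≠ 0 ∧
      hankelMinor (W * S) (W * B) B.transpose r c ≠ 0 ∧
      ∀ G : 𝒮, MvPolynomial.eval (markovMap δ G.1) p ≠ 0 → G ∈ U := by
    rintro U hU ⟨G, hGU⟩
    obtain ⟨U', hU', rfl⟩ := (@isOpen_induced_iff _ _ (zariskiTopology _) _ _).1 hU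
    obtain ⟨p, hp, hpU⟩ := exists_eval_ne_zero_of_isOpen hU' hGU
    have hG := hdeg G.1 G.2
    obtain ⟨A, B, C, hr⟩ := hG.1
    obtain ⟨W, S, B', hW, hS, hr'⟩ := exists_symmetric_realization hε hr hG ((h𝒮 hr).1 G.2).2
    obtain ⟨r, c, hrc⟩ := exists_hankelMinor_ne_zero hr' hG
    refine ⟨W, S, B', p, r, c, hW, hS, ?_, hrc, fun G' hG' => hpU _ hG'⟩
    have : symmetricMarkov δ W S B' = markovMap δ G.1 :=
      funext fun x => (markovMap_of_isRealization hr' δ x).symm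
    rw [this]
    exact hp
  refine ⟨fun U V hU hV hUn hVn => ?_⟩
  rw [Set.univ_inter] at hUn hVn ⊢
  obtain ⟨W₀, S₀, B₀, p, r, c, hW₀, hS₀, hp, hrc, hpU⟩ := hbasic U hU hUn
  obtain ⟨W₁, S₁, B₁, q, -, -, hW₁, hS₁, hq, -, hqV⟩ := hbasic V hV hVn
  let W := matrixLine W₀ W₁
  let S := matrixLine S₀ S₁
  let B := matrixLine B₀ B₁
  let P : MvPolynomial (Fin (2 * δ) × Fin n × Fin n) ℂ → Polynomial ℂ := fun p =>
    MvPolynomial.eval₂ Polynomial.C (symmetricMarkov δ W S B) p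
  have hP : ∀ p t, (P p).eval t = MvPolynomial.eval (symmetricMarkov δ (W₀ + t • (W₁ - W₀))
      (S₀ + t • (S₁ - S₀)) (B₀ + t • (B₁ - B₀))) p := by
    intro p t
    have h1 := MvPolynomial.eval₂_comp_left (Polynomial.evalRingHom t) Polynomial.C
      (symmetricMarkov δ W S B) p
    rw [Polynomial.coe_evalRingHom] at h1
    rw [h1, MvPolynomial.eval, MvPolynomial.coe_eval₂Hom]
    congr 1
    · ext a
      simp
    · ext x
      have h2 := map_symmetricMarkov (Polynomial.evalRingHom t) (δ := δ) W S B x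
      rw [map_eval_matrixLine, map_eval_matrixLine, map_eval_matrixLine] at h2
      exact h2
  let H : Polynomial ℂ := hankelMinor (W * S) (W * B) B.transpose r c
  have hH : ∀ t, H.eval t = hankelMinor ((W₀ + t • (W₁ - W₀)) * (S₀ + t • (S₁ - S₀)))
      ((W₀ + t • (W₁ - W₀)) * (B₀ + t • (B₁ - B₀))) (B₀ + t • (B₁ - B₀)).transpose r c := by
    intro t
    have h1 := map_hankelMinor (Polynomial.evalRingHom t) (W * S) (W * B) B.transpose r c
    rw [Matrix.map_mul, Matrix.map_mul, Matrix.transpose_map, map_eval_matrixLine,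
      map_eval_matrixLine, map_eval_matrixLine] at h1
    exact h1
  have hP0 : P p ≠ 0 := by
    intro h0
    have := hP p 0
    rw [h0] at this
    simp only [Polynomial.eval_zero, zero_smul, add_zero] at this
    exact hp this.symm
  have hQ0 : P q ≠ 0 := by
    intro h0
    have := hP q 1
    rw [h0] at this
    simp only [Polynomial.eval_zero, one_smul, add_sub_cancel] at this
    exact hq this.symm
  have hH0 : H ≠ 0 := by
    intro h0
    have := hH 0
    rw [h0] at this
    simp only [Polynomial.eval_zero, zero_smul, add_zero] at this
    exact hrc this.symm
  obtain ⟨t, ht⟩ := exists_eval_ne_zero_of_ne_zero (mul_ne_zero (mul_ne_zero hP0 hQ0) hH0)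
  rw [Polynomial.eval_mul, Polynomial.eval_mul, hP, hP, hH] at ht
  set Wt := W₀ + t • (W₁ - W₀) with hWt
  set St := S₀ + t • (S₁ - S₀) with hSt
  set Bt := B₀ + t • (B₁ - B₀) with hBt
  let G : Matrix (Fin n) (Fin n) (RatFunc ℂ) := Bt.transpose.map RatFunc.C *
    (Matrix.scalar (Fin δ) (RatFunc.X : RatFunc ℂ) - (Wt * St).map RatFunc.C)⁻¹ *
      (Wt * Bt).map RatFunc.C
  have hG : IsRealization G (Wt * St) (Wt * Bt) Bt.transpose := rfl
  have hWt' : Wt.transpose = ε • Wt := by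
    rw [hWt, Matrix.transpose_add, Matrix.transpose_smul, Matrix.transpose_sub, hW₀, hW₁,
      ← smul_sub, smul_comm, ← smul_add]
  have hSt' : St.transpose = St := by
    rw [hSt, Matrix.transpose_add, Matrix.transpose_smul, Matrix.transpose_sub, hS₀, hS₁]
  have hmem : G ∈ 𝒮 := (h𝒮 hG).2 ⟨hasMcMillanDegree_of_hankelMinor_ne_zero hG
    (right_ne_zero_of_mul ht), hasSymmetricMarkov_of_transpose_eq hWt' hSt' Bt⟩
  have hmk : symmetricMarkov δ Wt St Bt = markovMap δ G :=
    funext fun x => (markovMap_of_isRealization hG δ x).symm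
  rw [hmk] at ht
  exact ⟨⟨G, hmem⟩, hpU ⟨G, hmem⟩ (left_ne_zero_of_mul (left_ne_zero_of_mul ht)),
    hqV ⟨G, hmem⟩ (right_ne_zero_of_mul (left_ne_zero_of_mul ht))⟩

/-! ### A realization of a diagonal transfer function -/

section Diagonal

variable {n : ℕ} (m : Fin n → ℕ)

/-- The position of a state in the chain of nilpotent blocks. -/
def chainPos (x : Fin (∑ i, m i)) : (i : Fin n) × Fin (m i) := finSigmaFinEquiv.symm x

/-- The state matrix of the nilpotent blocks of sizes `m i`. -/
def chainA : Matrix (Fin (∑ i, m i)) (Fin (∑ i, m i)) ℂ :=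
  Matrix.of fun x y => if (chainPos m x).1 = (chainPos m y).1 ∧
    ((chainPos m x).2 : ℕ) = (chainPos m y).2 + 1 then 1 else 0

/-- The input matrix of the nilpotent blocks. -/
def chainB : Matrix (Fin (∑ i, m i)) (Fin n) ℂ :=
  Matrix.of fun x j => if (chainPos m x).1 = j ∧ ((chainPos m x).2 : ℕ) = 0 then 1 else 0

/-- The output matrix of the nilpotent blocks. -/
def chainC : Matrix (Fin n) (Fin (∑ i, m i)) ℂ :=
  Matrix.of fun i x => if (chainPos m x).1 = i ∧ ((chainPos m x).2 : ℕ) + 1 = m i then 1 else 0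

variable {m}

theorem chainPos_ext {x y : Fin (∑ i, m i)} (h1 : (chainPos m x).1 = (chainPos m y).1)
    (h2 : ((chainPos m x).2 : ℕ) = (chainPos m y).2) : x = y := by
  apply finSigmaFinEquiv.symm.injective
  change chainPos m x = chainPos m y
  generalize chainPos m x = X at *
  generalize chainPos m y = Y at *
  obtain ⟨i, a⟩ := X
  obtain ⟨j, b⟩ := Y
  simp only at h1
  subst h1
  simp only at h2
  rw [Fin.ext h2]

theorem exists_chainPos (i : Fin n) (a : ℕ) (ha : a < m i) :
    ∃ x, (chainPos m x).1 = i ∧ ((chainPos m x).2 : ℕ) = a :=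
  have h : chainPos m (finSigmaFinEquiv ⟨i, ⟨a, ha⟩⟩) = ⟨i, ⟨a, ha⟩⟩ :=
    finSigmaFinEquiv.symm_apply_apply _
  ⟨finSigmaFinEquiv ⟨i, ⟨a, ha⟩⟩, by rw [h], by rw [h]⟩

/-- The action of the nilpotent blocks on a vector, over any ring. -/
theorem sum_chainA_mul {R : Type*} [CommRing R] (f : ℂ →+* R) (v : Fin (∑ i, m i) → R)
    (w : Fin n → ℕ → R) (hv : ∀ x, v x = w (chainPos m x).1 (chainPos m x).2)
    (x : Fin (∑ i, m i)) :
    ∑ y, f (chainA m x y) * v y =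
      if ((chainPos m x).2 : ℕ) = 0 then 0 else w (chainPos m x).1 ((chainPos m x).2 - 1) := by
  split_ifs with h
  · refine Finset.sum_eq_zero fun y _ => ?_
    simp [chainA, h]
  · obtain ⟨y, hy1, hy2⟩ := exists_chainPos (m := m) (chainPos m x).1 ((chainPos m x).2 - 1)
      (by have := (chainPos m x).2.2; omega)
    rw [Finset.sum_eq_single y]
    · rw [hv, hy2, hy1]
      have : chainA m x y = 1 := by
        rw [chainA, Matrix.of_apply, if_pos ⟨hy1.symm, by omega⟩]
      rw [this, map_one, one_mul]
    · intro z _ hz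
      have : chainA m x z = 0 := by
        rw [chainA, Matrix.of_apply, if_neg]
        rintro ⟨h1, h2⟩
        exact hz (chainPos_ext (by rw [← h1, hy1]) (by omega))
      rw [this, map_zero, zero_mul]
    · simp

theorem chainA_pow_mul_chainB (k : ℕ) (x : Fin (∑ i, m i)) (j : Fin n) :
    (chainA m ^ k * chainB m) x j =
      if (chainPos m x).1 = j ∧ ((chainPos m x).2 : ℕ) = k then 1 else 0 := by
  induction k generalizing x with
  | zero => simp [chainB]
  | succ k ih =>
    rw [pow_succ', Matrix.mul_assoc, Matrix.mul_apply]
    have := sum_chainA_mul (RingHom.id ℂ) (fun y => (chainA m ^ k * chainB m) y j)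
      (fun i a => if i = j ∧ a = k then 1 else 0) ih x
    simp only [RingHom.id_apply] at this
    rw [this]
    by_cases h : ((chainPos m x).2 : ℕ) = 0
    · rw [if_pos h, if_neg (by omega)]
    · rw [if_neg h]
      have : ((chainPos m x).2 : ℕ) - 1 = k ↔ ((chainPos m x).2 : ℕ) = k + 1 := by omega
      simp only [this]

theorem sum_chainC_mul {R : Type*} [CommRing R] (f : ℂ →+* R) (v : Fin (∑ i, m i) → R)
    (w : Fin n → ℕ → R) (hv : ∀ x, v x = w (chainPos m x).1 (chainPos m x).2) {i : Fin n}
    (hi : 0 < m i) : ∑ y, f (chainC m i y) * v y = w i (m i - 1) := by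
  obtain ⟨y, hy1, hy2⟩ := exists_chainPos (m := m) i (m i - 1) (by omega)
  rw [Finset.sum_eq_single y]
  · have : chainC m i y = 1 := by
      rw [chainC, Matrix.of_apply, if_pos ⟨hy1, by omega⟩]
    rw [hv, hy2, hy1, this, map_one, one_mul]
  · intro z _ hz
    have : chainC m i z = 0 := by
      rw [chainC, Matrix.of_apply, if_neg]
      rintro ⟨h1, h2⟩
      exact hz (chainPos_ext (by rw [h1, hy1]) (by omega))
    rw [this, map_zero, zero_mul]
  · simp

theorem chainC_mul_pow_mul_chainB (hpos : ∀ i, 0 < m i) (k : ℕ) (i j : Fin n) :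
    (chainC m * chainA m ^ k * chainB m) i j = if i = j ∧ m i = k + 1 then 1 else 0 := by
  rw [Matrix.mul_assoc, Matrix.mul_apply]
  have := sum_chainC_mul (RingHom.id ℂ) (fun y => (chainA m ^ k * chainB m) y j)
      (fun i a => if i = j ∧ a = k then 1 else 0) (fun x => chainA_pow_mul_chainB k x j) (hpos i)
  simp only [RingHom.id_apply] at this
  rw [this]
  have h1 : m i - 1 = k ↔ m i = k + 1 := by have := hpos i; omega
  simp only [h1]

theorem isRealization_diagonalTransfer (hpos : ∀ i, 0 < m i) :
    IsRealization (diagonalTransfer m) (chainA m) (chainB m) (chainC m) := by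
  set M := Matrix.scalar (Fin (∑ i, m i)) (RatFunc.X : RatFunc ℂ) - (chainA m).map RatFunc.C with hM
  -- The solution of `(s I - A) N = B`: along a chain each step divides by `s` once more, so
  -- position `a`, counted from 0, carries `s^(-(a+1))`.
  let N : Matrix (Fin (∑ i, m i)) (Fin n) (RatFunc ℂ) := Matrix.of fun x j =>
    if (chainPos m x).1 = j then (RatFunc.X ^ (((chainPos m x).2 : ℕ) + 1))⁻¹ else 0
  have hX := RatFunc.X_ne_zero (K := ℂ)
  have h1 : M * N = (chainB m).map RatFunc.C := by
    ext1 x j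
    rw [hM, Matrix.sub_mul, Matrix.sub_apply, Matrix.scalar_apply, Matrix.diagonal_mul, Matrix.mul_apply]
    simp only [Matrix.map_apply]
    rw [sum_chainA_mul RatFunc.C (fun y => N y j)
      (fun i a => if i = j then (RatFunc.X ^ (a + 1))⁻¹ else 0) (fun x => rfl) x]
    simp only [N, chainB, Matrix.of_apply]
    by_cases hj : (chainPos m x).1 = j
    · by_cases h0 : ((chainPos m x).2 : ℕ) = 0
      · simp [hj, h0, hX]
      · obtain ⟨a, ha⟩ := Nat.exists_eq_succ_of_ne_zero h0
        simp only [hj, ha]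
        simp
        field_simp
        ring
    · simp [hj]
  have h2 : M⁻¹ * (chainB m).map RatFunc.C = N := by
    rw [← h1, ← Matrix.mul_assoc, Matrix.nonsing_inv_mul _ (isUnit_det_and_map_inv (chainA m)).1,
      Matrix.one_mul]
  unfold IsRealization
  rw [← hM, Matrix.mul_assoc, h2]
  ext1 i j
  rw [Matrix.mul_apply]
  simp only [Matrix.map_apply]
  rw [sum_chainC_mul RatFunc.C (fun y => N y j)
      (fun i a => if i = j then (RatFunc.X ^ (a + 1))⁻¹ else 0) (fun x => rfl) (hpos i),
      Nat.sub_add_cancel (hpos i), diagonalTransfer, Matrix.diagonal_apply]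

theorem hasMcMillanDegree_diagonalTransfer (hpos : ∀ i, 0 < m i) :
    HasMcMillanDegree (diagonalTransfer m) (∑ i, m i) := by
  let r : Fin (∑ i, m i) → ℕ × Fin n := fun x => ((chainPos m x).2, (chainPos m x).1)
  -- The entry `(i, i)` of `C A^k B` is 1 exactly for `k = m i - 1`. Pairing position `a` with `m i
  -- - 1 - a` therefore makes the Hankel submatrix the identity.
  let c : Fin (∑ i, m i) → ℕ × Fin n := fun x =>
    (m (chainPos m x).1 - 1 - (chainPos m x).2, (chainPos m x).1)
  apply hasMcMillanDegree_of_hankelMinor_ne_zero (isRealization_diagonalTransfer hpos)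
    (r := r) (c := c)
  have : (Matrix.of fun a b => (chainC m * chainA m ^ ((r a).1 + (c b).1) * chainB m)
      (r a).2 (c b).2) = 1 := by
    ext a b
    rw [Matrix.of_apply, chainC_mul_pow_mul_chainB hpos, Matrix.one_apply]
    refine if_congr ?_ rfl rfl
    have hb := (chainPos m b).2.2
    simp only [r, c]
    constructor
    · rintro ⟨h1, h2⟩
      refine chainPos_ext h1 ?_
      have h3 := congrArg m h1
      omega
    · rintro rfl
      exact ⟨rfl, by omega⟩
  rw [hankelMinor, this, Matrix.det_one]
  exact one_ne_zero

/-- Each Markov parameter is diagonal, with nonzero entries only at those `i` for which `k + 1 = m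
i`, so the symmetry reduces to `ε ^ m i = 1`. For `ε = -1` this asks for even exponents. -/
theorem hasSymmetricMarkov_chain (hpos : ∀ i, 0 < m i) {ε : ℂ} (hε : ∀ i, ε ^ m i = 1) :
    HasSymmetricMarkov ε (chainA m) (chainB m) (chainC m) := by
  intro k
  ext i j
  rw [Matrix.transpose_apply, Matrix.smul_apply, chainC_mul_pow_mul_chainB hpos,
    chainC_mul_pow_mul_chainB hpos]
  by_cases h : i = j
  · subst h
    by_cases hk : m i = k + 1
    · rw [if_pos ⟨rfl, hk⟩, ← hk, hε, one_smul]
    · simp [hk]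
  · simp [h, Ne.symm h]

end Diagonal

/-! ### Left coprime factorizations -/

section Coprime

open Polynomial Matrix

variable {n : ℕ}

/-- The map `(d, v) ↦ d G - v` on polynomial row vectors. -/
def leftFractionMap (G : Matrix (Fin n) (Fin n) (RatFunc ℂ)) :
    ((Fin n → ℂ[X]) × (Fin n → ℂ[X])) →ₗ[ℂ[X]] (Fin n → RatFunc ℂ) where
  toFun x := (fun j => algebraMap ℂ[X] (RatFunc ℂ) (x.1 j)) ᵥ* G -
    fun j => algebraMap ℂ[X] (RatFunc ℂ) (x.2 j)
  map_add' x y := by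
    ext j
    simp [vecMul, dotProduct, add_mul, Finset.sum_add_distrib]
    ring
  map_smul' c x := by
    ext j
    simp [vecMul, dotProduct, Algebra.smul_def, mul_sub, Finset.mul_sum, mul_assoc]

theorem mem_ker_leftFractionMap {G : Matrix (Fin n) (Fin n) (RatFunc ℂ)}
    {x : (Fin n → ℂ[X]) × (Fin n → ℂ[X])} :
    x ∈ (leftFractionMap G).ker ↔
      (fun j => algebraMap ℂ[X] (RatFunc ℂ) (x.1 j)) ᵥ* G =
        fun j => algebraMap ℂ[X] (RatFunc ℂ) (x.2 j) := by
  rw [LinearMap.mem_ker, leftFractionMap, LinearMap.coe_mk, AddHom.coe_mk, sub_eq_zero]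

theorem eq_zero_of_fst_eq_zero {G : Matrix (Fin n) (Fin n) (RatFunc ℂ)}
    {x : (Fin n → ℂ[X]) × (Fin n → ℂ[X])} (hx : x ∈ (leftFractionMap G).ker) (h1 : x.1 = 0) :
    x = 0 := by
  rw [mem_ker_leftFractionMap, h1] at hx
  refine Prod.ext h1 (funext fun j => ?_)
  have := congrFun hx j
  simp only [vecMul, dotProduct, Pi.zero_apply, map_zero, zero_mul, Finset.sum_const_zero] at this
  exact (map_eq_zero_iff _ (RatFunc.algebraMap_injective ℂ)).1 this.symm

/-- The range is finitely generated and torsion-free over the principal ideal domain `ℂ[X]`, hence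
free, so the kernel splits off. The retraction later provides the Bézout identity. -/
theorem exists_retraction_ker_leftFractionMap (G : Matrix (Fin n) (Fin n) (RatFunc ℂ)) :
    ∃ π : ((Fin n → ℂ[X]) × (Fin n → ℂ[X])) →ₗ[ℂ[X]] (leftFractionMap G).ker,
      ∀ x : (leftFractionMap G).ker, π x = x := by
  let φ := leftFractionMap G
  have hfree : Module.Free ℂ[X] φ.range := inferInstance
  obtain ⟨s, hs⟩ := Module.projective_lifting_property φ.rangeRestrict LinearMap.id
    φ.surjective_rangeRestrict
  have hs' : ∀ y, φ.rangeRestrict (s y) = y := fun y => LinearMap.congr_fun hs y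
  refine ⟨LinearMap.codRestrict _ (LinearMap.id - s ∘ₗ φ.rangeRestrict) fun x => ?_, fun x => ?_⟩
  · have h1 : φ (s (φ.rangeRestrict x)) = φ x := congrArg Subtype.val (hs' (φ.rangeRestrict x))
    change φ (x - s (φ.rangeRestrict x)) = 0
    rw [map_sub, h1, sub_self]
  · ext1
    have : φ.rangeRestrict x.1 = 0 := Subtype.ext x.2
    simp [this]

/-- The first component is injective on the kernel, which bounds the rank above by `n`. A common
denominator `q` of the entries of `G` embeds `ℂ[X]^n` by `d ↦ (q d, q d G)`, which bounds it below.
-/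
theorem finrank_ker_leftFractionMap (G : Matrix (Fin n) (Fin n) (RatFunc ℂ)) :
    Module.finrank ℂ[X] (leftFractionMap G).ker = n := by
  apply le_antisymm
  · have := LinearMap.finrank_le_finrank_of_injective
      (f := (LinearMap.fst ℂ[X] (Fin n → ℂ[X]) (Fin n → ℂ[X])) ∘ₗ (leftFractionMap G).ker.subtype)
      (by
        rw [injective_iff_map_eq_zero]
        intro x hx
        exact Subtype.ext (eq_zero_of_fst_eq_zero x.2 hx))
    simpa using this
  · obtain ⟨q, hq⟩ := IsLocalization.exist_integer_multiples_of_finite (nonZeroDivisors ℂ[X])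
      (fun ij : Fin n × Fin n => G ij.1 ij.2)
    choose N hN using hq
    have hq0 : (q : ℂ[X]) ≠ 0 := nonZeroDivisors.ne_zero q.2
    let f : (Fin n → ℂ[X]) →ₗ[ℂ[X]] (Fin n → ℂ[X]) × (Fin n → ℂ[X]) :=
      LinearMap.prod ((q : ℂ[X]) • LinearMap.id) (Matrix.vecMulLinear (Matrix.of fun i j => N (i, j)))
    have hf : ∀ d, f d ∈ (leftFractionMap G).ker := by
      intro d
      rw [mem_ker_leftFractionMap]
      ext j
      simp only [f, vecMul, dotProduct, LinearMap.prod_apply, Function.prod_apply,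
        LinearMap.smul_apply, LinearMap.id_apply, Pi.smul_apply, smul_eq_mul, map_mul,
        Matrix.vecMulLinear_apply, map_sum, Matrix.of_apply]
      refine Finset.sum_congr rfl fun i _ => ?_
      rw [hN (i, j), Algebra.smul_def]
      ring
    have := LinearMap.finrank_le_finrank_of_injective
      (f := LinearMap.codRestrict (leftFractionMap G).ker f hf) (by
        rw [injective_iff_map_eq_zero]
        intro d hd
        have h1 := congrArg (fun x => x.1.1) hd
        have h2 : (q : ℂ[X]) • d = 0 := h1
        exact (smul_eq_zero.1 h2).resolve_left hq0)
    simpa using this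

/-- The rows of `[D N]` form a basis of the polynomial solutions of `d G = v`. The coordinates of
the retraction on the standard basis vectors are the entries of `U` and `V`; that it fixes each row
of `[D N]` is `D U + N V = 1`. -/
theorem exists_isLeftCoprimeFactorization (G : Matrix (Fin n) (Fin n) (RatFunc ℂ)) :
    ∃ D N : Matrix (Fin n) (Fin n) ℂ[X], IsLeftCoprimeFactorization G D N := by
  obtain ⟨π, hπ⟩ := exists_retraction_ker_leftFractionMap G
  let b : Module.Basis (Fin n) ℂ[X] (leftFractionMap G).ker :=
    Module.finBasisOfFinrankEq _ _ (finrank_ker_leftFractionMap G)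
  let D : Matrix (Fin n) (Fin n) ℂ[X] := Matrix.of fun i => (b i).1.1
  let N : Matrix (Fin n) (Fin n) ℂ[X] := Matrix.of fun i => (b i).1.2
  have hDN : ∀ w : Fin n → ℂ[X], (∑ i, w i • b i).1 = (w ᵥ* D, w ᵥ* N) := by
    intro w
    rw [Submodule.coe_sum]
    ext j
    · simp [D, vecMul, dotProduct, Prod.fst_sum, Finset.sum_apply]
    · simp [N, vecMul, dotProduct, Prod.snd_sum, Finset.sum_apply]
  have hdet : D.det ≠ 0 := by
    intro h0
    obtain ⟨w, hw, hwD⟩ := Matrix.exists_vecMul_eq_zero_iff.2 h0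
    have h1 : (∑ i, w i • b i) = 0 := by
      apply Subtype.ext
      apply eq_zero_of_fst_eq_zero (Subtype.property _)
      rw [hDN, hwD]
    apply hw
    ext1 i
    exact Fintype.linearIndependent_iff.1 b.linearIndependent w h1 i
  refine ⟨D, N, hdet, ?_, ?_⟩
  · have hmul : D.map (algebraMap ℂ[X] (RatFunc ℂ)) * G = N.map (algebraMap ℂ[X] (RatFunc ℂ)) := by
      ext1 i j
      exact congrFun (mem_ker_leftFractionMap.1 (b i).2) j
    have hu : IsUnit (D.map (algebraMap ℂ[X] (RatFunc ℂ))).det := by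
      rw [← RingHom.mapMatrix_apply, ← RingHom.map_det, isUnit_iff_ne_zero, ne_eq,
        map_eq_zero_iff _ (RatFunc.algebraMap_injective ℂ)]
      exact hdet
    rw [← hmul, ← Matrix.mul_assoc, Matrix.nonsing_inv_mul _ hu, Matrix.one_mul]
  · refine ⟨Matrix.of fun j k => b.repr (π (Pi.single j 1, 0)) k,
      Matrix.of fun j k => b.repr (π (0, Pi.single j 1)) k, ?_⟩
    ext1 i k
    have h1 : (b i).1 = ∑ j, D i j • ((Pi.single j 1, 0) : (Fin n → ℂ[X]) × (Fin n → ℂ[X])) +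
        ∑ j, N i j • ((0, Pi.single j 1) : (Fin n → ℂ[X]) × (Fin n → ℂ[X])) := by
      ext1
      · ext1 l
        simp [D, Prod.fst_sum, Finset.sum_apply, Pi.single_apply]
      · ext1 l
        simp [N, Prod.snd_sum, Finset.sum_apply, Pi.single_apply]
    have h2 : b.repr (π (b i).1) k = (1 : Matrix (Fin n) (Fin n) ℂ[X]) i k := by
      rw [hπ, b.repr_self, Matrix.one_apply, Finsupp.single_apply]
    rw [← h2, h1]
    simp only [map_add, map_sum, map_smul, Finsupp.add_apply, Finsupp.finsetSum_apply,
      Finsupp.smul_apply, smul_eq_mul, Matrix.add_apply, Matrix.mul_apply, Matrix.of_apply]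

end Coprime

/-! ### Nondegeneracy in terms of the Markov parameters -/

theorem borderedMatrix_eq_fromBlocks {R : Type*} [CommRing R] {n : ℕ}
    (D N : Matrix (Fin n) (Fin n) R) (S : PluckerIndex n) :
    borderedMatrix D N S = Matrix.fromBlocks D N
      (Matrix.of fun a i => if S.col a = Sum.inl i then 1 else 0)
      (Matrix.of fun a i => if S.col a = Sum.inr i then 1 else 0) := by
  ext (i | i) (j | j) <;> simp [borderedMatrix]

theorem det_borderedMatrix_mul {R : Type*} [CommRing R] {n : ℕ}
    (D G : Matrix (Fin n) (Fin n) R) (S : PluckerIndex n) :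
    (borderedMatrix D (D * G) S).det = D.det * (borderedMatrix 1 G S).det := by
  have : borderedMatrix D (D * G) S = Matrix.fromBlocks D 0 0 1 * borderedMatrix 1 G S := by
    rw [borderedMatrix_eq_fromBlocks, borderedMatrix_eq_fromBlocks, Matrix.fromBlocks_multiply]
    simp
  rw [this, Matrix.det_mul, Matrix.det_fromBlocks_zero₂₁, Matrix.det_one, mul_one]

/-- A linear combination of the coefficients of the Plücker coordinates in the expansion of the
determinant of `[I G]` bordered by `n` rows. -/
def minorSum {R : Type*} [CommRing R] {n : ℕ} (G : Matrix (Fin n) (Fin n) R)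
    (z : PluckerIndex n → R) : R :=
  ∑ S, (borderedMatrix 1 G S).det * z S

theorem map_minorSum {R R' : Type*} [CommRing R] [CommRing R'] (f : R →+* R') {n : ℕ}
    (G : Matrix (Fin n) (Fin n) R) (z : PluckerIndex n → R) :
    f (minorSum G z) = minorSum (G.map f) (f ∘ z) := by
  simp only [minorSum, map_sum, map_mul, RingHom.map_det, RingHom.mapMatrix_apply,
    map_borderedMatrix, Function.comp_apply, Matrix.map_one f (map_zero f) (map_one f)]

-- Since `[D N] = D [I G]`, every cofactor is `det D` times a bordered determinant of `[I G]`. This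
-- also shows that the center does not depend on the factorization.
open Polynomial in
theorem mem_center_iff {n : ℕ} {G : Matrix (Fin n) (Fin n) (RatFunc ℂ)}
    {D N : Matrix (Fin n) (Fin n) ℂ[X]} (h : IsLeftCoprimeFactorization G D N)
    (z : PluckerSpace n) : z ∈ center D N ↔ minorSum G (RatFunc.C ∘ z.rep) = 0 := by
  obtain ⟨hdet, hG, -⟩ := h
  have hdet' : algebraMap ℂ[X] (RatFunc ℂ) D.det ≠ 0 := by
    rw [ne_eq, map_eq_zero_iff _ (RatFunc.algebraMap_injective ℂ)]
    exact hdet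
  have hu : IsUnit (D.map (algebraMap ℂ[X] (RatFunc ℂ))).det := by
    rw [← RingHom.mapMatrix_apply, ← RingHom.map_det]
    exact hdet'.isUnit
  have hN : N.map (algebraMap ℂ[X] (RatFunc ℂ)) = D.map (algebraMap ℂ[X] (RatFunc ℂ)) * G := by
    rw [hG, ← Matrix.mul_assoc, Matrix.mul_nonsing_inv _ hu, Matrix.one_mul]
  have key : algebraMap ℂ[X] (RatFunc ℂ) (∑ S, cofactor D N S * C (z.rep S)) =
      algebraMap ℂ[X] (RatFunc ℂ) D.det * minorSum G (RatFunc.C ∘ z.rep) := by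
    rw [map_sum, minorSum, Finset.mul_sum]
    refine Finset.sum_congr rfl fun S _ => ?_
    rw [map_mul, cofactor_eq_det, RingHom.map_det, RingHom.mapMatrix_apply, map_borderedMatrix, hN,
      det_borderedMatrix_mul, RingHom.map_det, RingHom.mapMatrix_apply, RatFunc.algebraMap_C,
      mul_assoc]
    rfl
  rw [← mul_eq_zero_iff_left hdet', ← key,
    map_eq_zero_iff _ (RatFunc.algebraMap_injective ℂ)]
  rfl

theorem isNondegenerate_iff {n : ℕ} {G : Matrix (Fin n) (Fin n) (RatFunc ℂ)} :
    IsNondegenerate G ↔ ∀ z ∈ LG n, minorSum G (RatFunc.C ∘ z.rep) ≠ 0 := by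
  constructor
  · rintro ⟨D, N, h, hempty⟩ z hz h0
    have : z ∈ center D N ∩ LG n := ⟨(mem_center_iff h z).2 h0, hz⟩
    rw [hempty] at this
    exact this
  · intro h
    obtain ⟨D, N, hDN⟩ := exists_isLeftCoprimeFactorization G
    refine ⟨D, N, hDN, ?_⟩
    rw [Set.eq_empty_iff_forall_notMem]
    rintro z ⟨hz, hzL⟩
    exact h z hzL ((mem_center_iff hDN z).1 hz)

open Polynomial in
/-- The degree of a determinant is bounded by the sum of bounds for the degrees of the rows. -/
theorem natDegree_det_le_sum {κ R : Type*} [Fintype κ] [DecidableEq κ] [CommRing R]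
    {M : Matrix κ κ R[X]} {d : κ → ℕ} (h : ∀ i j, (M i j).natDegree ≤ d i) :
    M.det.natDegree ≤ ∑ i, d i := by
  rw [Matrix.det_apply]
  refine natDegree_sum_le_of_forall_le _ _ fun σ _ => ?_
  refine (natDegree_smul_le _ _).trans ((natDegree_prod_le _ _).trans ?_)
  rw [← Equiv.sum_comp σ d]
  exact Finset.sum_le_sum fun i _ => h (σ i) i

/-! ### Reduction to finitely many coefficients of the expansion at infinity. -/

section Expansion

variable {n δ : ℕ}

open Polynomial in
/-- The product of the denominator `det (I - t A)` with a coefficient of a Plücker coordinate, as a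
polynomial. -/
def numeratorMatrix (A : Matrix (Fin δ) (Fin δ) ℂ) (B : Matrix (Fin δ) (Fin n) ℂ)
    (C : Matrix (Fin n) (Fin δ) ℂ) (S : PluckerIndex n) :
    Matrix (Fin δ ⊕ (Fin n ⊕ Fin n)) (Fin δ ⊕ (Fin n ⊕ Fin n)) ℂ[X] :=
  Matrix.fromBlocks (1 - (X : ℂ[X]) • A.map Polynomial.C)
    (Matrix.fromCols 0 ((X : ℂ[X]) • B.map Polynomial.C))
    (Matrix.fromRows (-C.map Polynomial.C) 0) (borderedMatrix 1 0 S)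

-- The variable occurs only in the first `δ` rows, and there linearly.
open Polynomial in
theorem natDegree_det_numeratorMatrix_le (A : Matrix (Fin δ) (Fin δ) ℂ)
    (B : Matrix (Fin δ) (Fin n) ℂ) (C : Matrix (Fin n) (Fin δ) ℂ) (S : PluckerIndex n) :
    (numeratorMatrix A B C S).det.natDegree ≤ δ := by
  have hone : ∀ {κ : Type} [DecidableEq κ] (i j : κ), ((1 : Matrix κ κ ℂ[X]) i j).natDegree = 0 := by
    intro κ _ i j
    rw [Matrix.one_apply]
    split_ifs <;> simp
  refine (natDegree_det_le_sum (d := Sum.elim (fun _ => 1) fun _ => 0) ?_).trans ?_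
  · rintro (i | i | i) (j | j | j)
    · simp only [numeratorMatrix, Matrix.fromBlocks_apply₁₁, Matrix.sub_apply, Matrix.smul_apply,
        Matrix.map_apply, smul_eq_mul, Sum.elim_inl]
      refine (natDegree_sub_le _ _).trans (max_le ?_ ?_)
      · rw [hone]; exact Nat.zero_le _
      · exact (natDegree_mul_C_le _ _).trans natDegree_X_le
    · simp [numeratorMatrix]
    · simp only [numeratorMatrix, Matrix.fromBlocks_apply₁₂, Matrix.fromCols_apply_inr,
        Matrix.smul_apply, Matrix.map_apply, smul_eq_mul, Sum.elim_inl]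
      exact (natDegree_mul_C_le _ _).trans natDegree_X_le
    · simp [numeratorMatrix]
    · simp [numeratorMatrix, borderedMatrix, hone]
    · simp [numeratorMatrix, borderedMatrix]
    · simp [numeratorMatrix]
    · simp only [numeratorMatrix, borderedMatrix, Matrix.fromBlocks_apply₂₂,
        Matrix.fromRows_apply_inr, Matrix.of_apply, Sum.elim_inr]
      split_ifs <;> simp
    · simp only [numeratorMatrix, borderedMatrix, Matrix.fromBlocks_apply₂₂,
        Matrix.fromRows_apply_inr, Matrix.of_apply, Sum.elim_inr]
      split_ifs <;> simp
  · simp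

theorem map_coe_numeratorMatrix (A : Matrix (Fin δ) (Fin δ) ℂ)
    (B : Matrix (Fin δ) (Fin n) ℂ) (C : Matrix (Fin n) (Fin δ) ℂ) (S : PluckerIndex n) :
    (numeratorMatrix A B C S).map (Polynomial.coeToPowerSeries.ringHom (R := ℂ)) =
      Matrix.fromBlocks (1 - (PowerSeries.X : PowerSeries ℂ) • A.map (PowerSeries.C (R := ℂ)))
        (Matrix.fromCols 0 ((PowerSeries.X : PowerSeries ℂ) • B.map (PowerSeries.C (R := ℂ))))
        (Matrix.fromRows (-C.map (PowerSeries.C (R := ℂ))) 0) (borderedMatrix 1 0 S) := by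
  have h1 : ∀ {κ ν : Type} (M : Matrix κ ν ℂ), (M.map Polynomial.C).map
      (Polynomial.coeToPowerSeries.ringHom (R := ℂ)) = M.map (PowerSeries.C (R := ℂ)) := by
    intro κ ν M
    ext1 i j
    simp
  have h2 : ∀ {κ ν : Type} (M : Matrix κ ν ℂ), ((Polynomial.X : Polynomial ℂ) •
      M.map Polynomial.C).map (Polynomial.coeToPowerSeries.ringHom (R := ℂ)) =
      (PowerSeries.X : PowerSeries ℂ) • M.map (PowerSeries.C (R := ℂ)) := by
    intro κ ν M
    ext1 i j
    simp
    exact mul_comm _ _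
  rw [numeratorMatrix, Matrix.fromBlocks_map, map_borderedMatrix, Matrix.map_sub, h2]
  rotate_left
  · exact fun a b => map_sub _ a b
  rw [Matrix.map_one _ (map_zero _) (map_one _), Matrix.map_one _ (map_zero _) (map_one _),
    Matrix.map_zero _ (map_zero _)]
  congr 1
  · ext1 i j
    rcases j with j | j
    · simp
    · simp
      exact mul_comm _ _
  · ext1 i j
    rcases i with i | i <;> simp

/-- The Schur complement of the block `I - t A` in `numeratorMatrix` is the bordered matrix of the
expansion, as `C (I - t A)⁻¹ t B` is the realization series. -/
theorem det_mul_det_borderedMatrix (A : Matrix (Fin δ) (Fin δ) ℂ)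
    (B : Matrix (Fin δ) (Fin n) ℂ) (C : Matrix (Fin n) (Fin δ) ℂ) (S : PluckerIndex n) :
    (1 - (PowerSeries.X : PowerSeries ℂ) • A.map (PowerSeries.C (R := ℂ))).det *
      (borderedMatrix 1 (realizationSeries A B C) S).det =
        ((numeratorMatrix A B C S).det : PowerSeries ℂ) := by
  have h0 : ((numeratorMatrix A B C S).det : PowerSeries ℂ) =
      Polynomial.coeToPowerSeries.ringHom (numeratorMatrix A B C S).det := rfl
  have hinv := one_sub_mul_resolventSeries A
  let _ : Invertible (1 - (PowerSeries.X : PowerSeries ℂ) • A.map (PowerSeries.C (R := ℂ))) :=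
    ⟨resolventSeries A, mul_eq_one_comm.1 hinv, hinv⟩
  rw [h0, RingHom.map_det, RingHom.mapMatrix_apply, map_coe_numeratorMatrix,
    Matrix.det_fromBlocks₁₁]
  congr 2
  have h1 : ⅟(1 - (PowerSeries.X : PowerSeries ℂ) • A.map (PowerSeries.C (R := ℂ))) =
      resolventSeries A := rfl
  rw [h1, Matrix.fromRows_mul, Matrix.fromRows_mul_fromCols, realizationSeries_eq,
    borderedMatrix_eq_fromBlocks, borderedMatrix_eq_fromBlocks]
  ext1 i j
  rcases i with i | i <;> rcases j with j | j <;> simp [Matrix.mul_smul]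

/-- The matrix of polynomials `∑ H_k t^(k+1)` of the first `2δ` Markov parameters. -/
def truncatedSeries {R : Type*} [CommRing R] (x : Fin (2 * δ) × Fin n × Fin n → R) :
    Matrix (Fin n) (Fin n) (Polynomial R) :=
  Matrix.of fun i j => ∑ k : Fin (2 * δ), Polynomial.C (x (k, i, j)) * Polynomial.X ^ (k.1 + 1)

theorem map_truncatedSeries {R R' : Type*} [CommRing R] [CommRing R'] (f : R →+* R')
    (x : Fin (2 * δ) × Fin n × Fin n → R) :
    (truncatedSeries x).map (Polynomial.mapRingHom f) = truncatedSeries (f ∘ x) := by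
  ext1 i j
  simp [truncatedSeries, Polynomial.map_sum]

/-- The coefficients of the linear forms in the Plücker coordinates that define the center, as
polynomials in the Markov parameters. -/
def centerForm (n δ : ℕ) (k : Fin (2 * δ + 1)) (S : PluckerIndex n) :
    MvPolynomial (Fin (2 * δ) × Fin n × Fin n) ℂ :=
  (borderedMatrix 1 (truncatedSeries MvPolynomial.X) S).det.coeff k

theorem eval_centerForm (k : Fin (2 * δ + 1)) (S : PluckerIndex n)
    (x : Fin (2 * δ) × Fin n × Fin n → ℂ) :
    MvPolynomial.eval x (centerForm n δ k S) =
      (borderedMatrix 1 (truncatedSeries x) S).det.coeff k := by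
  rw [centerForm, ← Polynomial.coeff_map, ← Polynomial.coe_mapRingHom, RingHom.map_det,
    RingHom.mapMatrix_apply, map_borderedMatrix, map_truncatedSeries,
    Matrix.map_one _ (map_zero _) (map_one _)]
  congr 4
  ext y
  simp

theorem X_pow_dvd_realizationSeries_sub {A : Matrix (Fin δ) (Fin δ) ℂ}
    {B : Matrix (Fin δ) (Fin n) ℂ} {C : Matrix (Fin n) (Fin δ) ℂ}
    {x : Fin (2 * δ) × Fin n × Fin n → ℂ}
    (hx : ∀ y, x y = (C * A ^ (y.1 : ℕ) * B) y.2.1 y.2.2) (i j : Fin n) :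
    (PowerSeries.X : PowerSeries ℂ) ^ (2 * δ + 1) ∣
      realizationSeries A B C i j - (truncatedSeries x i j : PowerSeries ℂ) := by
  rw [PowerSeries.X_pow_dvd_iff]
  intro k hk
  rw [map_sub, Polynomial.coeff_coe, truncatedSeries, Matrix.of_apply, Polynomial.finsetSum_coeff]
  simp only [Polynomial.coeff_C_mul, Polynomial.coeff_X_pow]
  rcases k with _ | k
  · simp [realizationSeries]
  · rw [Finset.sum_eq_single ⟨k, by omega⟩]
    · simp [realizationSeries, PowerSeries.coeff_succ_X_mul, hx]
    · intro l _ hl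
      rw [if_neg, mul_zero]
      intro h
      exact hl (Fin.ext (by simp only; omega))
    · simp

/-- The two matrices agree modulo `t^(2δ+1)`, hence so do their determinants. -/
theorem coeff_det_borderedMatrix_eq {A : Matrix (Fin δ) (Fin δ) ℂ}
    {B : Matrix (Fin δ) (Fin n) ℂ} {C : Matrix (Fin n) (Fin δ) ℂ}
    {x : Fin (2 * δ) × Fin n × Fin n → ℂ}
    (hx : ∀ y, x y = (C * A ^ (y.1 : ℕ) * B) y.2.1 y.2.2) (S : PluckerIndex n)
    (k : Fin (2 * δ + 1)) :
    PowerSeries.coeff (k : ℕ) (borderedMatrix 1 (realizationSeries A B C) S).det =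
      (borderedMatrix 1 (truncatedSeries x) S).det.coeff k := by
  let I : Ideal (PowerSeries ℂ) := Ideal.span {PowerSeries.X ^ (2 * δ + 1)}
  have hmap : (borderedMatrix 1 (realizationSeries A B C) S).map (Ideal.Quotient.mk I) =
      ((borderedMatrix 1 (truncatedSeries x) S).map
        (Polynomial.coeToPowerSeries.ringHom (R := ℂ))).map (Ideal.Quotient.mk I) := by
    rw [map_borderedMatrix, map_borderedMatrix, map_borderedMatrix]
    congr 1
    · rw [Matrix.map_one _ (map_zero _) (map_one _), Matrix.map_one _ (map_zero _) (map_one _),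
        Matrix.map_one _ (map_zero _) (map_one _)]
    · ext1 i j
      rw [Matrix.map_apply, Matrix.map_apply, Ideal.Quotient.eq, Ideal.mem_span_singleton]
      exact X_pow_dvd_realizationSeries_sub hx i j
  have hdet := congrArg Matrix.det hmap
  rw [← RingHom.mapMatrix_apply, ← RingHom.map_det, ← RingHom.mapMatrix_apply, ← RingHom.map_det,
    ← RingHom.mapMatrix_apply, ← RingHom.map_det, Ideal.Quotient.eq, Ideal.mem_span_singleton,
    PowerSeries.X_pow_dvd_iff] at hdet
  have h := hdet k k.2
  rw [map_sub, sub_eq_zero] at h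
  rw [h]
  exact Polynomial.coeff_coe _ _

/-- Multiplied by `det (I - t A)`, the expansion becomes a polynomial of degree at most `δ`.
Vanishing of the coefficients up to `t^(2δ)`, which the first `2δ` Markov parameters determine, is
thus more than enough. -/
theorem minorSum_eq_zero_iff {G : Matrix (Fin n) (Fin n) (RatFunc ℂ)}
    {A : Matrix (Fin δ) (Fin δ) ℂ} {B : Matrix (Fin δ) (Fin n) ℂ} {C : Matrix (Fin n) (Fin δ) ℂ}
    (h : IsRealization G A B C) (z : PluckerIndex n → ℂ) :
    minorSum G (RatFunc.C ∘ z) = 0 ↔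
      ∀ k, ∑ S, MvPolynomial.eval (markovMap δ G) (centerForm n δ k S) * z S = 0 := by
  have h1 : minorSum G (RatFunc.C ∘ z) = 0 ↔
      minorSum (realizationSeries A B C) (PowerSeries.C (R := ℂ) ∘ z) = 0 := by
    rw [← map_eq_zero_iff expandHom expandHom_injective,
      ← map_eq_zero_iff (HahnSeries.ofPowerSeries ℤ ℂ) HahnSeries.ofPowerSeries_injective,
      map_minorSum, map_minorSum, map_expandHom_of_isRealization h]
    have : expandHom ∘ RatFunc.C ∘ z =
        HahnSeries.ofPowerSeries ℤ ℂ ∘ PowerSeries.C (R := ℂ) ∘ z := by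
      ext1 S
      simp [expandHom_C]
    rw [this]
  rw [h1]
  have hcoeff : ∀ k : Fin (2 * δ + 1),
      ∑ S, MvPolynomial.eval (markovMap δ G) (centerForm n δ k S) * z S =
      PowerSeries.coeff (k : ℕ)
        (minorSum (realizationSeries A B C) (PowerSeries.C (R := ℂ) ∘ z)) := by
    intro k
    rw [minorSum, map_sum]
    refine Finset.sum_congr rfl fun S _ => ?_
    rw [Function.comp_apply, PowerSeries.coeff_mul_C, eval_centerForm,
      coeff_det_borderedMatrix_eq (markovMap_of_isRealization h δ)]
  constructor
  · intro h0 k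
    rw [hcoeff, h0, map_zero]
  · intro h0
    set f := minorSum (realizationSeries A B C) (PowerSeries.C (R := ℂ) ∘ z) with hf
    have hdvd : (PowerSeries.X : PowerSeries ℂ) ^ (2 * δ + 1) ∣ f := by
      rw [PowerSeries.X_pow_dvd_iff]
      intro k hk
      rw [← hcoeff ⟨k, hk⟩]
      exact h0 _
    set ρ := (1 - (PowerSeries.X : PowerSeries ℂ) • A.map (PowerSeries.C (R := ℂ))).det with hρ
    have hρ0 : ρ ≠ 0 := by
      intro h2
      have h3 := congrArg Matrix.det (one_sub_mul_resolventSeries A)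
      rw [Matrix.det_mul, ← hρ, h2, zero_mul, Matrix.det_one] at h3
      exact zero_ne_one h3
    let q : Polynomial ℂ := ∑ S, (numeratorMatrix A B C S).det * Polynomial.C (z S)
    have hq : ρ * f = (q : PowerSeries ℂ) := by
      have : (q : PowerSeries ℂ) = Polynomial.coeToPowerSeries.ringHom q := rfl
      rw [this, hf, minorSum, Finset.mul_sum, map_sum]
      refine Finset.sum_congr rfl fun S _ => ?_
      rw [← mul_assoc, det_mul_det_borderedMatrix, map_mul]
      simp
    have hdeg : q.natDegree ≤ δ := by
      refine Polynomial.natDegree_sum_le_of_forall_le _ _ fun S _ => ?_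
      exact (Polynomial.natDegree_mul_C_le _ _).trans (natDegree_det_numeratorMatrix_le A B C S)
    have hq0 : q = 0 := by
      ext k
      rw [Polynomial.coeff_zero]
      by_cases hk : k < 2 * δ + 1
      · rw [← Polynomial.coeff_coe, ← hq]
        exact (PowerSeries.X_pow_dvd_iff.1 (hdvd.mul_left ρ)) k hk
      · exact Polynomial.coeff_eq_zero_of_natDegree_lt (by omega)
    rw [hq0, Polynomial.coe_zero] at hq
    exact (mul_eq_zero.1 hq).resolve_left hρ0

end Expansion

theorem isOpen_isNondegenerate {n δ : ℕ} {𝒮 : Set (Matrix (Fin n) (Fin n) (RatFunc ℂ))}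
    (hdeg : ∀ G ∈ 𝒮, HasMcMillanDegree G δ) :
    @IsOpen 𝒮 (transferTopology δ 𝒮) {G : 𝒮 | IsNondegenerate G.1} := by
  refine (@isOpen_induced_iff _ _ (zariskiTopology _) _ _).2
    ⟨_, isOpen_forall_exists_ne_zero {z | ∃ F : Matrix (Fin n) (Fin n) ℂ, F.IsSymm ∧
      z = Projectivization.mk ℂ (plucker F 1) (plucker_graph_ne_zero F)} (centerForm n δ), ?_⟩
  ext G
  obtain ⟨A, B, C, h⟩ := (hdeg G.1 G.2).1
  change (∀ z ∈ LG n, ∃ k, _) ↔ IsNondegenerate G.1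
  rw [isNondegenerate_iff]
  refine forall₂_congr fun z _ => ?_
  rw [ne_eq, minorSum_eq_zero_iff h, not_forall]

/-! ### Genericity of nondegeneracy -/

/-- The diagonal example supplies the nonempty open set. Distinctness of the `m i` makes it
nondegenerate, `hεm` puts it into the family, and `hδ` fixes its degree. -/
theorem isGeneric_isNondegenerate {n δ : ℕ} {ε : ℂ} (hε : ε * ε = 1)
    {𝒮 : Set (Matrix (Fin n) (Fin n) (RatFunc ℂ))}
    (h𝒮 : ∀ {d : ℕ} {G} {A : Matrix (Fin d) (Fin d) ℂ} {B : Matrix (Fin d) (Fin n) ℂ}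
      {C : Matrix (Fin n) (Fin d) ℂ}, IsRealization G A B C →
        (G ∈ 𝒮 ↔ HasMcMillanDegree G δ ∧ HasSymmetricMarkov ε A B C))
    (hdeg : ∀ G ∈ 𝒮, HasMcMillanDegree G δ) {m : Fin n → ℕ} (hm : Function.Injective m)
    (hpos : ∀ i, 0 < m i) (hεm : ∀ i, ε ^ m i = 1) (hδ : ∑ i, m i = δ) :
    IsGeneric δ 𝒮 IsNondegenerate := by
  have hmem : diagonalTransfer m ∈ 𝒮 :=
    (h𝒮 (isRealization_diagonalTransfer hpos)).2
      ⟨hδ ▸ hasMcMillanDegree_diagonalTransfer hpos, hasSymmetricMarkov_chain hpos hεm⟩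
  have hne : {G : 𝒮 | IsNondegenerate G.1}.Nonempty :=
    ⟨⟨_, hmem⟩, isNondegenerate_diagonalTransfer hm hpos⟩
  let _ := transferTopology δ 𝒮
  have : PreirreducibleSpace 𝒮 := preirreducibleSpace_of_symmetric hε h𝒮 hdeg
  have hopen := isOpen_isNondegenerate hdeg
  exact ⟨hne, hopen, hopen.dense hne⟩

end TransferFunction

end

/-- In the limit case `δ = n(n+1)/2` (symmetric) or `δ = n(n+1)` (Hamiltonian), a generic
transfer function of McMillan degree `δ` is nondegenerate. -/
theorem mainTheorem4 (n : ℕ) :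
    TransferFunction.IsGeneric ((n + 1).choose 2) (TransferFunction.SRat n ((n + 1).choose 2))
      TransferFunction.IsNondegenerate ∧
    TransferFunction.IsGeneric (n * (n + 1)) (TransferFunction.Ham n (n * (n + 1)))
      TransferFunction.IsNondegenerate := by
  have hsum : ∑ i : Fin n, ((i : ℕ) + 1) = (n + 1).choose 2 := by
    rw [Fin.sum_univ_eq_sum_range fun i => i + 1, ← Finset.sum_range_succ' (fun i => i) n |>.trans
      (add_zero _), Finset.sum_range_id, Nat.choose_two_right]
  constructor
  -- The exponents `1, …, n` are the smallest distinct positive ones, with sum `n(n+1)/2`.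
  · exact TransferFunction.isGeneric_isNondegenerate (ε := 1) (one_mul 1)
      TransferFunction.mem_SRat_iff (fun G hG => hG.2.1) (m := fun i => (i : ℕ) + 1)
      (fun i j h => Fin.ext (by simpa using h)) (fun i => Nat.succ_pos _) (fun i => one_pow _) hsum
  -- Since `(-1) ^ m i = 1` requires even exponents, they are doubled to `2, 4, …, 2n`, with sum
  -- `n(n+1)`.
  · refine TransferFunction.isGeneric_isNondegenerate (ε := -1) (by norm_num)
      TransferFunction.mem_Ham_iff (fun G hG => hG.2.1) (m := fun i => 2 * ((i : ℕ) + 1))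
      (fun i j h => Fin.ext (by simpa using h)) (fun i => by omega) (fun i => by simp [pow_mul]) ?_
    rw [← Finset.mul_sum, hsum, Nat.choose_two_right, Nat.mul_div_cancel' (Nat.even_mul_pred_self _).two_dvd]
    simp [mul_comm]
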